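/- **Setting.** Let $n\ge 1$, $\lambda_z>0$, and let $R$ be a probability law on $(0,\infty)$. To a countable set of vehicles $C$ belong independent random variables: sojourn times $Z_C\sim\mathrm{Exp}(\lambda_z)$ and recruitment durations $U_C\sim R$. At time $0$ each of $n$ groups is processed by two vehicles, all $2n$ of them distinct; vehicle $C$ departs at time $Z_C$. When one of the two vehicles of a group departs at time $s$, the other one, $C$, becomes a recruiter; unless it departs earlier, it completes its recruitment at time $s+U_C$ (event $e^{\mathsf R}(C)$) by assigning to the group an arbitrary vehicle that is still present and processes no group. If a recruiter departs before that, the system fails (state $F$). The system is in $S_i$ $(0\le i\le n)$ if exactly $i$ groups have only one vehicle. This is the process (I-SMP) that models $\mathtt{RP\text{-}VC}_n$. **Event dynamic variables.** An event dynamic variable (EDV) is a composite expression $V=M-N$ in the above variables, together with its defining relation $M>N$ and those of $M$ and $N$; an expression that is not such a difference is simple (SRV). "$V$ follows $\alpha$" means that $V$ is composed as below, and that $\alpha$ is its conditional distribution given the defining relations of $V$. With $Z_1,Z_2$ independent sojourn times and $U,U'$ independent recruitment durations: $\dot{\exp}$ is the type of $Z_1-Z_2$; $\ddot{\exp}$ of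 $Z_1-(Z_2+U)$; $\varphi$ of $U-(Z_1-Z_2)$; $\psi$ of $U'-W$ and $\gamma$ of $W-U'$ with $W=U-(Z_1-Z_2)$. For $V=M-N$ put $\hat\Gamma(V)=\hat\Gamma(M)$, $\hat\delta(V)=\hat\delta(M)+N+\hat\delta(N)$, $\hat\xi(V)=V+\hat\delta(V)-\hat\Gamma(V)$, and for an SRV $\hat\Gamma(V)=V$, $\hat\delta(V)=0$. Write $V_1\dot\preceq V_2$ if both are EDVs with $\hat\Gamma(V_1)\ne\hat\Gamma(V_2)$, $\hat\delta(V_1)=\hat\delta(V_2)$ and $\hat\xi(V_1)\le\hat\xi(V_2)$, or if $V_1$ is an EDV and $V_2$ an SRV. A list is an EDL $\mathcal L^{(\alpha)}\langle m\rangle$ if it has $m$ entries, all following $\alpha$ and with their defining relations satisfied, and is increasing for $\dot\preceq$; an H-EDL $\mathcal H^{(\alpha;\alpha')}\langle p;q\rangle$ is a list of $p+q$ variables, increasing for $\dot\preceq$ and with their defining relations satisfied, of which the first $p$ follow $\alpha$ and the last $q$ follow $\alpha'$. The order of a recruiter is $1$ plus the number of other recruiters whose residual recruitment times are $\dot\preceq$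 its own. **Theorem (Decomposition).** Each $S_i$ with $i<n$ is decomposed into $i+2$ H-states $S_{i,0},\dots,S_{i,i+1}$, and $S_n$ has the single H-state $S_{n,0}$. To each finite history of the system (the sequence of events so far, with the recruited vehicles) belong an H-state and two lists of expressions in the $Z_C,U_C$, such that almost surely, at each time at which the system starts or an event has just occurred and it has not failed, the following holds. 1. The system is in $S_i$ if and only if the H-state is one of those of $S_i$. The two lists are the residual sojourn times of the $2n-i$ vehicles processing the groups and the residual recruitment times of the $i$ recruiters. They are - $S_{0,0}=\{[Z_1,\dots,Z_{2n}],[\,]\}$, and $S_{0,1}=\{\mathcal L^{(\ddot\exp)}\langle 2n\rangle,[\,]\}$; - $S_{i,0}=\{\mathcal L^{(\dot\exp)}\langle 2n-i\rangle,\mathcal H^{(\varphi;R)}\langle i-1;1\rangle\}$ for $1\le i\le n$; - $S_{i,j}=\{\mathcal L^{(\ddot\exp)}\langle 2n-i\rangle,\mathcal H^{(\gamma;\psi)}\langle j-1;i-(j-1)\rangle\}$ for $1\le i\le n-1$, $1\le j\le i+1$. The $k$-th entry of the second list belongs to the recruiter of order $k$. 2. Exactly one of the scheduled events occurs next. The system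 starts in $S_{0,0}$. From any H-state of $S_i$, the departure of a vehicle that is not a recruiter leads to $S_{i+1,0}$; the completion of recruitment by the recruiter of order $j$ leads to $S_{i-1,j}$; and the departure of a recruiter, and only this, leads to $F$. The H-states are time-homogeneous: for each history of positive probability, the joint distribution of the two lists, conditional on their defining relations (those of all their entries, and the $\dot\preceq$-monotonicity of the second list), is a law $\nu_{i,j}$ that depends only on the H-state $S_{i,j}$ and on $n,\lambda_z,R$, and not on the time or the way in which the H-state was entered. Let $Q(S_{i,j},s;t)$ be the probability under $\nu_{i,j}$ that one entry of the two lists is at most $t$ and strictly smaller than all others, and that the corresponding event leads to the state $s$ in the sense of 2. Then, for each H-state $S_{i,j}$ that is entered with positive probability, $\sum_s\lim_{t\to\infty}Q(S_{i,j},s;t)=1$, the sum being over all H-states and $F$. Thus $Q$ is the kernel of a time-homogeneous semi-Markov process, the decomposed SMP (D-SMP). -/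

import Mathlib

open MeasureTheory ProbabilityTheory

/-! ### Event dynamic variables -/

/-- Formal expressions in the sojourn times `Z c` and the recruitment durations `U c` of the
vehicles `c : V`.  `diff M N` is the expression `M - N`; every other expression is simple. -/
inductive EVar (V : Type*) where
  | Z (c : V)
  | U (c : V)
  | sum (M N : EVar V)
  | diff (M N : EVar V)

namespace EVar

variable {V : Type*}

/-- The value of an expression for given sojourn times `z` and recruitment durations `u`. -/
def eval (z u : V → ℝ) : EVar V → ℝ
  | Z c => z c
  | U c => u c
  | sum M N => eval z u M + eval z u N
  | diff M N => eval z u M - eval z u N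

/-- Composite expressions `M - N`. -/
def IsDiff : EVar V → Prop
  | diff _ _ => True
  | _ => False

/-- `V` is an event dynamic variable (or a positive simple random variable) for the outcome
`(z, u)`: all simple constituents are positive, and in each difference `M - N` one has `M > N`. -/
def IsEDVAt (z u : V → ℝ) : EVar V → Prop
  | diff M N => IsEDVAt z u M ∧ IsEDVAt z u N ∧ eval z u N < eval z u M
  | sum M N => IsEDVAt z u M ∧ IsEDVAt z u N
  | Z c => 0 < z c
  | U c => 0 < u c

/-- Duration. -/
def duration : EVar V → EVar V
  | diff M _ => duration M
  | W => W

/-- Reducer. -/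
def reducer (z u : V → ℝ) : EVar V → ℝ
  | diff M N => reducer z u M + (eval z u N + reducer z u N)
  | _ => 0

/-- Pivot. -/
def pivot (z u : V → ℝ) (W : EVar V) : ℝ :=
  eval z u W + reducer z u W - eval z u (duration W)

/-- `PivLE z u V₁ V₂`: `V₂` is pivotally greater than or equal to `V₁`, with the convention
that a simple random variable is pivotally greater than any difference. -/
def PivLE (z u : V → ℝ) (V₁ V₂ : EVar V) : Prop :=
  (IsDiff V₁ ∧ ¬ IsDiff V₂) ∨
  (IsDiff V₁ ∧ IsDiff V₂ ∧ duration V₁ ≠ duration V₂ ∧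
    reducer z u V₂ = reducer z u V₁ ∧ pivot z u V₁ ≤ pivot z u V₂)

end EVar

/-! ### Event distributions -/

/-- The distribution of `M - N` given `M > N`, for independent `M ∼ P` and `N ∼ Q`. -/
noncomputable def diffLaw (P Q : Measure ℝ) : Measure ℝ :=
  (cond (P.prod Q) {p : ℝ × ℝ | p.2 < p.1}).map (fun p => p.1 - p.2)

/-- Names of the distributions: the recruitment law `R`, the first and second order composite
exponential, `φ`, `ψ` and `γ`. -/
inductive EventLaw where
  | recr
  | expDot
  | expDDot
  | phi
  | psi
  | gamma

/-- The distributions, for sojourn rate `lam` and recruitment law `R`. -/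
noncomputable def EventLaw.law (lam : ℝ) (R : Measure ℝ) : EventLaw → Measure ℝ
  | recr => R
  | expDot => diffLaw (expMeasure lam) (expMeasure lam)
  | expDDot => diffLaw (expMeasure lam) (((expMeasure lam).prod R).map (fun p => p.1 + p.2))
  | phi => diffLaw R (diffLaw (expMeasure lam) (expMeasure lam))
  | psi => diffLaw R (diffLaw R (diffLaw (expMeasure lam) (expMeasure lam)))
  | gamma => diffLaw (diffLaw R (diffLaw (expMeasure lam) (expMeasure lam))) R

/-- The composition of a variable of each kind out of independent sojourn times and recruitment
durations (those of different vehicles are independent copies). -/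
def EventLaw.Form {V : Type*} : EventLaw → EVar V → Prop
  | recr, W => ∃ k, W = .U k
  | expDot, W => ∃ x b, x ≠ b ∧ W = .diff (.Z x) (.Z b)
  | expDDot, W => ∃ x a k, x ≠ a ∧ W = .diff (.Z x) (.sum (.Z a) (.U k))
  | phi, W => ∃ k b a, b ≠ a ∧ W = .diff (.U k) (.diff (.Z b) (.Z a))
  | psi, W => ∃ k l b a, k ≠ l ∧ b ≠ a ∧
      W = .diff (.U k) (.diff (.U l) (.diff (.Z b) (.Z a)))
  | gamma, W => ∃ k l b a, k ≠ l ∧ b ≠ a ∧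
      W = .diff (.diff (.U k) (.diff (.Z b) (.Z a))) (.U l)

/-- The vehicles' sojourn times `Z c` (exponential with rate `lam`) and recruitment durations
`U c` (law `R`) are independent random variables. -/
structure IsSeSVC {Ω V : Type*} [MeasurableSpace Ω] (μ : Measure Ω) (Z U : V → Ω → ℝ)
    (lam : ℝ) (R : Measure ℝ) : Prop where
  measurable_Z : ∀ c, Measurable (Z c)
  measurable_U : ∀ c, Measurable (U c)
  indep : iIndepFun (Sum.elim Z U) μ
  law_Z : ∀ c, μ.map (Z c) = expMeasure lam
  law_U : ∀ c, μ.map (U c) = R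

section Lists

variable {Ω V : Type*} [MeasurableSpace Ω] (μ : Measure Ω) (Z U : V → Ω → ℝ)
  (lam : ℝ) (R : Measure ℝ)

/-- `W ∼ α`: the variable `W` is composed as prescribed by `α`, and, given that it is an event
dynamic variable, its distribution is `α`. -/
def Follows (α : EventLaw) (W : EVar V) : Prop :=
  α.Form W ∧
  (cond μ {ω | W.IsEDVAt (fun c => Z c ω) (fun c => U c ω)}).map
    (fun ω => W.eval (fun c => Z c ω) (fun c => U c ω)) = α.law lam R

/-- `l` is, at the outcome `ω`, an event dynamic list whose members follow `α`. -/
def IsEDL (ω : Ω) (α : EventLaw) {m : ℕ} (l : Fin m → EVar V) : Prop :=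
  (∀ k, (l k).IsEDVAt (fun c => Z c ω) (fun c => U c ω) ∧ Follows μ Z U lam R α (l k)) ∧
  ∀ k k', k < k' → EVar.PivLE (fun c => Z c ω) (fun c => U c ω) (l k) (l k')

/-- `l` is, at the outcome `ω`, a heterogeneous event dynamic list: the first `p` members
follow `α`, the last `q` members follow `α'`. -/
def IsHEDL (ω : Ω) (α α' : EventLaw) (p q : ℕ) {m : ℕ} (l : Fin m → EVar V) : Prop :=
  m = p + q ∧
  (∀ k, (l k).IsEDVAt (fun c => Z c ω) (fun c => U c ω)) ∧
  (∀ k : Fin m, (k : ℕ) < p → Follows μ Z U lam R α (l k)) ∧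
  (∀ k : Fin m, p ≤ (k : ℕ) → Follows μ Z U lam R α' (l k)) ∧
  ∀ k k', k < k' → EVar.PivLE (fun c => Z c ω) (fun c => U c ω) (l k) (l k')

end Lists

/-! ### The dynamics of the redundancy-based processing of `n` groups -/

/-- A group is processed by two vehicles, or by one vehicle `c` which is recruiting since
time `s`. -/
inductive GroupStatus (V : Type*) where
  | pair (c d : V)
  | single (c : V) (s : ℝ)

/-- Vehicle `c` processes the group. -/
def GroupStatus.Has {V : Type*} : GroupStatus V → V → Prop
  | pair c d, x => x = c ∨ x = d
  | single c _, x => x = c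

def GroupStatus.isSingle {V : Type*} : GroupStatus V → Bool
  | pair _ _ => false
  | single _ _ => true

/-- A configuration: the current time and the status of each of the `n` groups. -/
structure VCConfig (V : Type*) (n : ℕ) where
  time : ℝ
  status : Fin n → GroupStatus V

namespace VCConfig

variable {V : Type*} {n : ℕ}

def Active (X : VCConfig V n) (c : V) : Prop := ∃ g, (X.status g).Has c

/-- The index `i` of the state `S_i`: the number of groups with only one vehicle. -/
def level (X : VCConfig V n) : ℕ :=
  (Finset.univ.filter (fun g => (X.status g).isSingle = true)).card

end VCConfig

/-- The events: departure of a vehicle, completion of a recruitment by a vehicle. -/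
inductive VCEvent (V : Type*) where
  | depart (c : V)
  | recruit (c : V)

/-- An event, together with the recruited vehicle `y` if it is a recruitment. -/
inductive Move (V : Type*) where
  | depart (c : V)
  | recruit (c y : V)

/-- The events that are scheduled in configuration `X`, with their times of occurrence. -/
inductive Pending {V : Type*} {n : ℕ} (z u : V → ℝ) (X : VCConfig V n) :
    VCEvent V → ℝ → Prop where
  | depart {c : V} (hc : X.Active c) : Pending z u X (.depart c) (z c)
  | recruit {g : Fin n} {c : V} {s : ℝ} (hg : X.status g = .single c s) :
      Pending z u X (.recruit c) (s + u c)

/-- Event `e` occurs, at time `t`, before all other scheduled events. -/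
def IsNext {V : Type*} {n : ℕ} (z u : V → ℝ) (X : VCConfig V n) (e : VCEvent V) (t : ℝ) :
    Prop :=
  Pending z u X e t ∧ ∀ e' t', Pending z u X e' t' → e' ≠ e → t < t'

/-- One transition.  The result `none` is the failure state `F`.  A recruiter may recruit any
vehicle `y` that is still present and does not process a group. -/
inductive Step {V : Type*} {n : ℕ} (z u : V → ℝ) (X : VCConfig V n) :
    Move V → Option (VCConfig V n) → Prop where
  | departLeft {g : Fin n} {c d : V} (hg : X.status g = .pair c d)
      (hn : IsNext z u X (.depart c) (z c)) :
      Step z u X (.depart c) (some ⟨z c, Function.update X.status g (.single d (z c))⟩)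
  | departRight {g : Fin n} {c d : V} (hg : X.status g = .pair c d)
      (hn : IsNext z u X (.depart d) (z d)) :
      Step z u X (.depart d) (some ⟨z d, Function.update X.status g (.single c (z d))⟩)
  | recruit {g : Fin n} {c y : V} {s : ℝ} (hg : X.status g = .single c s)
      (hn : IsNext z u X (.recruit c) (s + u c)) (hy : ¬ X.Active y) (hz : s + u c < z y) :
      Step z u X (.recruit c y)
        (some ⟨s + u c, Function.update X.status g (.pair c y)⟩)
  | fail {g : Fin n} {c : V} {s : ℝ} (hg : X.status g = .single c s)
      (hn : IsNext z u X (.depart c) (z c)) : Step z u X (.depart c) none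

/-- `Run z u alloc h X`: starting at time `0` with the vehicles `alloc g 0`, `alloc g 1` on each
group `g`, the system goes through the history `h` and is then in configuration `X`. -/
inductive Run {V : Type*} {n : ℕ} (z u : V → ℝ) (alloc : Fin n → Fin 2 → V) :
    List (Move V) → Option (VCConfig V n) → Prop where
  | start : Run z u alloc [] (some ⟨0, fun g => .pair (alloc g 0) (alloc g 1)⟩)
  | step {h : List (Move V)} {X : VCConfig V n} {m : Move V} {X' : Option (VCConfig V n)}
      (hr : Run z u alloc h (some X)) (hs : Step z u X m X') : Run z u alloc (h ++ [m]) X'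

/-! ### H-states -/

/-- The index pairs `(i, j)` of the H-states `S_{i,j}` into which `S_i` is decomposed. -/
def hStates (n i : ℕ) : Finset (ℕ × ℕ) :=
  if i < n then (Finset.range (i + 2)).image (fun j => (i, j)) else {(n, 0)}

/-- The two lists describing an H-state `S_{i,j}`, with the vehicles they refer to. -/
structure HDesc (V : Type*) (n i : ℕ) where
  vehicle : Fin (2 * n - i) → V
  sojourn : Fin (2 * n - i) → EVar V
  recruiter : Fin i → V
  recruitment : Fin i → EVar V

/-- The order of the `k`-th recruiter: its rank with respect to the pivotal comparison of the
residual recruitment times. -/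
noncomputable def HDesc.order {V : Type*} {n i : ℕ} (z u : V → ℝ) (d : HDesc V n i)
    (k : Fin i) : ℕ :=
  {l : Fin i | l ≠ k ∧ EVar.PivLE z u (d.recruitment l) (d.recruitment k)}.ncard + 1

/-- The lists of `d` are the residual sojourn times of the vehicles that process the groups in
configuration `X`, the recruiters coming first, and the residual recruitment times of the
recruiters. -/
structure HDesc.Describes {V : Type*} {n i : ℕ} (z u : V → ℝ) (X : VCConfig V n)
    (d : HDesc V n i) : Prop where
  vehicle_inj : Function.Injective d.vehicle
  vehicle_iff : ∀ c, X.Active c ↔ ∃ k, d.vehicle k = c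
  sojourn_eq : ∀ k, (d.sojourn k).eval z u = z (d.vehicle k) - X.time
  recruiter_inj : Function.Injective d.recruiter
  recruiter_iff : ∀ c, (∃ g s, X.status g = .single c s) ↔ ∃ k, d.recruiter k = c
  recruitment_eq : ∀ k g s, X.status g = .single (d.recruiter k) s →
    (d.recruitment k).eval z u = s + u (d.recruiter k) - X.time
  recruiter_first : ∀ (k : Fin (2 * n - i)) (l : Fin i), (k : ℕ) = l →
    d.vehicle k = d.recruiter l

/-- At the outcome `ω`, the lists of `d` are those of the H-state `S_{i,j}`. -/
def HDesc.IsHState {Ω V : Type*} [MeasurableSpace Ω] (μ : Measure Ω) (Z U : V → Ω → ℝ)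
    (lam : ℝ) (R : Measure ℝ) (ω : Ω) {n i : ℕ} (j : ℕ) (d : HDesc V n i) : Prop :=
  if j = 0 then
    if i = 0 then ∀ k, d.sojourn k = .Z (d.vehicle k)
    else IsEDL μ Z U lam R ω .expDot d.sojourn ∧
      IsHEDL μ Z U lam R ω .phi .recr (i - 1) 1 d.recruitment
  else IsEDL μ Z U lam R ω .expDDot d.sojourn ∧
    IsHEDL μ Z U lam R ω .gamma .psi (j - 1) (i - (j - 1)) d.recruitment

/-- The defining relations of the two lists: all entries are event dynamic variables, and the
residual recruitment times are pivotally increasing. -/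
def HDesc.Relations {V : Type*} {n i : ℕ} (z u : V → ℝ) (d : HDesc V n i) : Prop :=
  (∀ k, (d.sojourn k).IsEDVAt z u) ∧ (∀ k, (d.recruitment k).IsEDVAt z u) ∧
  ∀ k l, k < l → EVar.PivLE z u (d.recruitment k) (d.recruitment l)

/-- Values of the residual sojourn times and the residual recruitment times. -/
abbrev Residuals (n i : ℕ) : Type := (Fin (2 * n - i) → ℝ) × (Fin i → ℝ)

def HDesc.values {V : Type*} {n i : ℕ} (z u : V → ℝ) (d : HDesc V n i) : Residuals n i :=
  (fun k => (d.sojourn k).eval z u, fun k => (d.recruitment k).eval z u)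

/-- The joint distribution of the two lists, given their defining relations. -/
noncomputable def HDesc.jointLaw {Ω V : Type*} [MeasurableSpace Ω] (μ : Measure Ω)
    (Z U : V → Ω → ℝ) {n i : ℕ} (d : HDesc V n i) : Measure (Residuals n i) :=
  (cond μ {ω | d.Relations (fun c => Z c ω) (fun c => U c ω)}).map
    (fun ω => d.values (fun c => Z c ω) (fun c => U c ω))

/-! ### The decomposed semi-Markov process -/

/-- The states of the decomposed process: the H-states `S_{i,j}` and the failure state `F`. -/
inductive DState where
  | H (i j : ℕ)
  | F
deriving DecidableEq

/-- The set of all states of the decomposed process. -/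
def dStates (n : ℕ) : Finset DState :=
  insert .F ((Finset.range (n + 1)).biUnion
    (fun i => (hStates n i).image (fun q => DState.H q.1 q.2)))

/-- The state entered from any `S_{i,j}` if the given entry of the two lists runs out first:
`F` after the departure of a recruiter, `S_{i+1,0}` after the departure of another vehicle,
and `S_{i-1,k}` if the recruiter of order `k` completes its recruitment. -/
def dTarget (n i : ℕ) : Fin (2 * n - i) ⊕ Fin i → DState
  | Sum.inl k => if (k : ℕ) < i then .F else .H (i + 1) 0
  | Sum.inr k => .H (i - 1) (k + 1)

/-- The semi-Markov kernel of the decomposed process, for given laws `ν i j` of the residual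
times in the H-states: the probability to go from `S_{i,j}` to `s` within time `t`. -/
noncomputable def dKernel (n : ℕ) (ν : ∀ i _j : ℕ, Measure (Residuals n i)) (i j : ℕ)
    (s : DState) (t : ℝ) : ENNReal :=
  ν i j {p | ∃ e, dTarget n i e = s ∧ Sum.elim p.1 p.2 e ≤ t ∧
    ∀ e', e' ≠ e → Sum.elim p.1 p.2 e < Sum.elim p.1 p.2 e'}

/-! The dynamics of the system is determined by the times at which vehicles depart and recruitments
are completed, so all that has to be remembered of a history is which vehicle came to each place of
each group, which of the places have been left, in which order, and how the last event fits into
this order. If `T` is the time of the last event, every residual time is a difference `E - T`, where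
`E` is a sojourn time `Z x` or the completion time `Z a + U c` of the recruitment which `c` began
when `a` departed. Here `T` is `Z b` or `Z b + U d`, and a rearrangement of `Z a + U c - T` makes it
a composite expression with duration `U c`, reducer `T` and pivot `Z a`. Hence the pivotal order of
the recruiters is the order of the departures that they make up for, and the defining relations of
the two lists only say that these departures occurred in the recorded order and that all scheduled
events lie ahead.

Since no vehicle appears in two different roles of the same kind, neither the lists nor their
relations involve a variable in more than one role, and by independence the conditional joint law
is the same for all histories which lead to a given H-state. Almost surely no two scheduled events
coincide, so exactly one of them is the next, and the kernel has total mass one. -/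

/-! ### Conditional laws of event dynamic variables -/

section ConditionalLaws

variable {Ω α β : Type*} [MeasurableSpace α] [MeasurableSpace β]

theorem map_cond_preimage [MeasurableSpace Ω] {μ : Measure Ω} {f : Ω → α} (hf : Measurable f)
    {S : Set α} (hS : MeasurableSet S) : (cond μ (f ⁻¹' S)).map f = cond (μ.map f) S := by
  simp only [ProbabilityTheory.cond, Measure.map_apply hf hS, Measure.map_smul,
    Measure.restrict_map hf hS]

theorem cond_inter_map_prodMk {m₁ m₂ mΩ : MeasurableSpace Ω} {μ : Measure Ω} [IsFiniteMeasure μ]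
    (h₁ : m₁ ≤ mΩ) (h₂ : m₂ ≤ mΩ) (hind : Indep m₁ m₂ μ) {A B : Set Ω}
    (hA : MeasurableSet[m₁] A) (hB : MeasurableSet[m₂] B) {M : Ω → α} {N : Ω → β}
    (hM : Measurable[m₁] M) (hN : Measurable[m₂] N) :
    (cond μ (A ∩ B)).map (fun ω => (M ω, N ω)) = ((cond μ A).map M).prod ((cond μ B).map N) := by
  have hmul := (Indep_iff m₁ m₂ μ).1 hind
  have hM' : Measurable M := hM.mono h₁ le_rfl
  have hN' : Measurable N := hN.mono h₂ le_rfl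
  refine (Measure.prod_eq fun s t hs ht => ?_).symm
  have hrect : A ∩ B ∩ (fun ω => (M ω, N ω)) ⁻¹' s ×ˢ t = (A ∩ M ⁻¹' s) ∩ (B ∩ N ⁻¹' t) := by
    rw [← Set.inter_inter_inter_comm]
    rfl
  rw [Measure.map_apply (hM'.prodMk hN') (hs.prod ht), Measure.map_apply hM' hs,
    Measure.map_apply hN' ht, cond_apply ((h₁ _ hA).inter (h₂ _ hB)), cond_apply (h₁ _ hA),
    cond_apply (h₂ _ hB), hrect, hmul _ _ hA hB, hmul _ _ (hA.inter (hM hs)) (hB.inter (hN ht)),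
    ENNReal.mul_inv (Or.inr (measure_ne_top _ _)) (Or.inl (measure_ne_top _ _))]
  ring

theorem cond_of_ae_mem [MeasurableSpace Ω] {μ : Measure Ω} [IsProbabilityMeasure μ] {A : Set Ω}
    (h : ∀ᵐ ω ∂μ, ω ∈ A) : cond μ A = μ := by
  have hA : μ A = 1 := (measure_congr (Filter.eventuallyEq_univ.2 h)).trans measure_univ
  rw [ProbabilityTheory.cond, hA, inv_one, one_smul, Measure.restrict_eq_self_of_ae_mem h]

theorem ae_ne_of_indepFun [MeasurableSpace Ω] [MeasurableEq α]
    {μ : Measure Ω} [IsFiniteMeasure μ] {X Y : Ω → α} (hX : Measurable X) (hY : Measurable Y)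
    (h : IndepFun X Y μ) [NullSingletonClass (μ.map X)] : ∀ᵐ ω ∂μ, X ω ≠ Y ω := by
  have hdiag : MeasurableSet {p : α × α | p.2 = p.1} :=
    measurableSet_eq_fun measurable_snd measurable_fst
  have hprod := (indepFun_iff_map_prod_eq_prod_map_map hY.aemeasurable hX.aemeasurable).1 h.symm
  have hzero : (μ.map fun ω => (Y ω, X ω)) {p : α × α | p.2 = p.1} = 0 := by
    rw [hprod, Measure.measure_prod_null hdiag]
    exact .of_forall fun y => measure_singleton y
  exact (ae_of_ae_map (hY.prodMk hX).aemeasurable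
    (measure_eq_zero_iff_ae_notMem.1 hzero)).mono fun _ => id

end ConditionalLaws

instance nullSingletonClass_expMeasure (r : ℝ) : NullSingletonClass (expMeasure r) :=
  ⟨fun _ => withDensity_absolutelyContinuous _ _ (measure_singleton _)⟩

theorem expMeasure_Iic_zero (r : ℝ) : expMeasure r (Set.Iic 0) = 0 := by
  rw [measure_congr Iio_ae_eq_Iic.symm, expMeasure, gammaMeasure,
    withDensity_apply _ measurableSet_Iio, lintegral_gammaPDF_of_nonpos le_rfl]

namespace EVar

variable {Ω V : Type*}

/-- The random variables which occur in an expression: `Sum.inl c` stands for the sojourn time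
and `Sum.inr c` for the recruitment duration of `c`. -/
def vars : EVar V → Set (V ⊕ V)
  | Z c => {Sum.inl c}
  | U c => {Sum.inr c}
  | sum M N => vars M ∪ vars N
  | diff M N => vars M ∪ vars N

theorem measurable_eval {m : MeasurableSpace Ω} {Z U : V → Ω → ℝ} (W : EVar V)
    (h : ∀ x ∈ W.vars, Measurable (Sum.elim Z U x)) :
    Measurable fun ω => W.eval (Z · ω) (U · ω) := by
  induction W with
  | Z c => exact h (Sum.inl c) rfl
  | U c => exact h (Sum.inr c) rfl
  | sum M N hM hN =>
    exact (hM fun x hx => h x (Or.inl hx)).add (hN fun x hx => h x (Or.inr hx))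
  | diff M N hM hN =>
    exact (hM fun x hx => h x (Or.inl hx)).sub (hN fun x hx => h x (Or.inr hx))

theorem measurableSet_isEDVAt {m : MeasurableSpace Ω} {Z U : V → Ω → ℝ} (W : EVar V)
    (h : ∀ x ∈ W.vars, Measurable (Sum.elim Z U x)) :
    MeasurableSet {ω | W.IsEDVAt (Z · ω) (U · ω)} := by
  induction W with
  | Z c => exact measurableSet_lt measurable_const (h (Sum.inl c) rfl)
  | U c => exact measurableSet_lt measurable_const (h (Sum.inr c) rfl)
  | sum M N hM hN =>
    exact (hM fun x hx => h x (Or.inl hx)).inter (hN fun x hx => h x (Or.inr hx))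
  | diff M N hM hN =>
    have hM' : ∀ x ∈ M.vars, Measurable (Sum.elim Z U x) := fun x hx => h x (Or.inl hx)
    have hN' : ∀ x ∈ N.vars, Measurable (Sum.elim Z U x) := fun x hx => h x (Or.inr hx)
    exact (hM hM').inter
      ((hN hN').inter (measurableSet_lt (N.measurable_eval hN') (M.measurable_eval hM')))

/-- The distribution of an expression given its defining relations. -/
noncomputable def condLaw [MeasurableSpace Ω] (μ : Measure Ω) (Z U : V → Ω → ℝ) (W : EVar V) :
    Measure ℝ :=
  (cond μ {ω | W.IsEDVAt (Z · ω) (U · ω)}).map fun ω => W.eval (Z · ω) (U · ω)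

end EVar

/-- The σ-algebra generated by the sojourn times and recruitment durations in `S`. -/
@[reducible]
def sigmaVars {Ω V : Type*} (Z U : V → Ω → ℝ) (S : Set (V ⊕ V)) : MeasurableSpace Ω :=
  ⨆ x ∈ S, MeasurableSpace.comap (Sum.elim Z U x) inferInstance

theorem measurable_sigmaVars {Ω V : Type*} (Z U : V → Ω → ℝ) {S : Set (V ⊕ V)} :
    ∀ x ∈ S, Measurable[sigmaVars Z U S] (Sum.elim Z U x) := fun x hx =>
  measurable_iff_comap_le.2
    (le_iSup₂ (f := fun x (_ : x ∈ S) => MeasurableSpace.comap (Sum.elim Z U x) inferInstance) x hx)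

namespace IsSeSVC

variable {Ω V : Type*} [MeasurableSpace Ω] {μ : Measure Ω} {Z U : V → Ω → ℝ}
  {lam : ℝ} {R : Measure ℝ}

theorem measurable_elim (H : IsSeSVC μ Z U lam R) (x : V ⊕ V) : Measurable (Sum.elim Z U x) := by
  cases x with
  | inl c => exact H.measurable_Z c
  | inr c => exact H.measurable_U c

theorem measurable_eval (H : IsSeSVC μ Z U lam R) (W : EVar V) :
    Measurable fun ω => W.eval (Z · ω) (U · ω) :=
  W.measurable_eval fun x _ => H.measurable_elim x

theorem measurableSet_isEDVAt (H : IsSeSVC μ Z U lam R) (W : EVar V) :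
    MeasurableSet {ω | W.IsEDVAt (Z · ω) (U · ω)} :=
  W.measurableSet_isEDVAt fun x _ => H.measurable_elim x

theorem sigmaVars_le (H : IsSeSVC μ Z U lam R) (S : Set (V ⊕ V)) :
    sigmaVars Z U S ≤ ‹MeasurableSpace Ω› :=
  iSup₂_le fun x _ => (H.measurable_elim x).comap_le

theorem indep_sigmaVars (H : IsSeSVC μ Z U lam R) {S T : Set (V ⊕ V)} (h : Disjoint S T) :
    Indep (sigmaVars Z U S) (sigmaVars Z U T) μ :=
  indep_iSup_of_disjoint (fun x => (H.measurable_elim x).comap_le)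
    ((iIndepFun_iff_iIndep _ _ _).1 H.indep) h

theorem ae_pos_Z (H : IsSeSVC μ Z U lam R) (c : V) : ∀ᵐ ω ∂μ, 0 < Z c ω :=
  (ae_of_ae_map (H.measurable_Z c).aemeasurable <| H.law_Z c ▸
    measure_eq_zero_iff_ae_notMem.1 (expMeasure_Iic_zero lam)).mono fun _ => Set.notMem_Iic.1

theorem ae_pos_U (H : IsSeSVC μ Z U lam R) (hR : R (Set.Iic 0) = 0) (c : V) :
    ∀ᵐ ω ∂μ, 0 < U c ω :=
  (ae_of_ae_map (H.measurable_U c).aemeasurable <| H.law_U c ▸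
    measure_eq_zero_iff_ae_notMem.1 hR).mono fun _ => Set.notMem_Iic.1

variable [IsProbabilityMeasure μ]

theorem condLaw_Z (H : IsSeSVC μ Z U lam R) (c : V) :
    (EVar.Z c).condLaw μ Z U = expMeasure lam := by
  have h : ∀ᵐ ω ∂μ, ω ∈ {ω | (EVar.Z c).IsEDVAt (Z · ω) (U · ω)} := H.ae_pos_Z c
  rw [EVar.condLaw, cond_of_ae_mem h]
  exact H.law_Z c

theorem condLaw_U (H : IsSeSVC μ Z U lam R) (hR : R (Set.Iic 0) = 0) (c : V) :
    (EVar.U c).condLaw μ Z U = R := by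
  have h : ∀ᵐ ω ∂μ, ω ∈ {ω | (EVar.U c).IsEDVAt (Z · ω) (U · ω)} := H.ae_pos_U hR c
  rw [EVar.condLaw, cond_of_ae_mem h]
  exact H.law_U c

theorem map_eval_prodMk (H : IsSeSVC μ Z U lam R) {M N : EVar V} (h : Disjoint M.vars N.vars) :
    (cond μ ({ω | M.IsEDVAt (Z · ω) (U · ω)} ∩ {ω | N.IsEDVAt (Z · ω) (U · ω)})).map
        (fun ω => (M.eval (Z · ω) (U · ω), N.eval (Z · ω) (U · ω))) =
      (M.condLaw μ Z U).prod (N.condLaw μ Z U) :=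
  cond_inter_map_prodMk (H.sigmaVars_le _) (H.sigmaVars_le _) (H.indep_sigmaVars h)
    (M.measurableSet_isEDVAt (measurable_sigmaVars Z U))
    (N.measurableSet_isEDVAt (measurable_sigmaVars Z U))
    (M.measurable_eval (measurable_sigmaVars Z U)) (N.measurable_eval (measurable_sigmaVars Z U))

theorem condLaw_sum (H : IsSeSVC μ Z U lam R) {M N : EVar V} (h : Disjoint M.vars N.vars) :
    (EVar.sum M N).condLaw μ Z U =
      ((M.condLaw μ Z U).prod (N.condLaw μ Z U)).map fun p => p.1 + p.2 := by
  rw [← H.map_eval_prodMk h,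
    Measure.map_map (by fun_prop) ((H.measurable_eval M).prodMk (H.measurable_eval N))]
  rfl

theorem condLaw_diff (H : IsSeSVC μ Z U lam R) {M N : EVar V} (h : Disjoint M.vars N.vars) :
    (EVar.diff M N).condLaw μ Z U = diffLaw (M.condLaw μ Z U) (N.condLaw μ Z U) := by
  have hlt : MeasurableSet {p : ℝ × ℝ | p.2 < p.1} :=
    measurableSet_lt measurable_snd measurable_fst
  have hpair := (H.measurable_eval M).prodMk (H.measurable_eval N)
  rw [diffLaw, ← H.map_eval_prodMk h, ← map_cond_preimage hpair hlt,
    cond_cond_eq_cond_inter ((H.measurableSet_isEDVAt M).inter (H.measurableSet_isEDVAt N))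
      (hpair hlt),
    Measure.map_map (by fun_prop) hpair, EVar.condLaw, Set.inter_assoc]
  rfl

theorem condLaw_expDot (H : IsSeSVC μ Z U lam R) {b a : V} (h : b ≠ a) :
    (EVar.diff (.Z b) (.Z a)).condLaw μ Z U = EventLaw.expDot.law lam R := by
  rw [H.condLaw_diff (by simpa [EVar.vars] using h), H.condLaw_Z, H.condLaw_Z, EventLaw.law]

theorem condLaw_phi (H : IsSeSVC μ Z U lam R) (hR : R (Set.Iic 0) = 0) (k : V) {b a : V}
    (h : b ≠ a) :
    (EVar.diff (.U k) (.diff (.Z b) (.Z a))).condLaw μ Z U = EventLaw.phi.law lam R := by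
  rw [H.condLaw_diff (by simp [EVar.vars]), H.condLaw_U hR, H.condLaw_expDot h]
  rfl

theorem follows_recr (H : IsSeSVC μ Z U lam R) (hR : R (Set.Iic 0) = 0) (k : V) :
    Follows μ Z U lam R .recr (.U k) :=
  ⟨⟨k, rfl⟩, H.condLaw_U hR k⟩

theorem follows_expDot (H : IsSeSVC μ Z U lam R) {x b : V} (h : x ≠ b) :
    Follows μ Z U lam R .expDot (.diff (.Z x) (.Z b)) :=
  ⟨⟨x, b, h, rfl⟩, H.condLaw_expDot h⟩

theorem follows_phi (H : IsSeSVC μ Z U lam R) (hR : R (Set.Iic 0) = 0) (k : V) {b a : V}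
    (h : b ≠ a) : Follows μ Z U lam R .phi (.diff (.U k) (.diff (.Z b) (.Z a))) :=
  ⟨⟨k, b, a, h, rfl⟩, H.condLaw_phi hR k h⟩

theorem follows_expDDot (H : IsSeSVC μ Z U lam R) (hR : R (Set.Iic 0) = 0) {x a : V}
    (h : x ≠ a) (k : V) :
    Follows μ Z U lam R .expDDot (.diff (.Z x) (.sum (.Z a) (.U k))) := by
  refine ⟨⟨x, a, k, h, rfl⟩, (H.condLaw_diff (by simpa [EVar.vars] using h)).trans ?_⟩
  rw [H.condLaw_sum (by simp [EVar.vars]), H.condLaw_Z, H.condLaw_Z, H.condLaw_U hR, EventLaw.law]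

theorem follows_psi (H : IsSeSVC μ Z U lam R) (hR : R (Set.Iic 0) = 0) {k l b a : V}
    (hkl : k ≠ l) (h : b ≠ a) :
    Follows μ Z U lam R .psi (.diff (.U k) (.diff (.U l) (.diff (.Z b) (.Z a)))) := by
  refine ⟨⟨k, l, b, a, hkl, h, rfl⟩, (H.condLaw_diff (by simpa [EVar.vars] using hkl)).trans ?_⟩
  rw [H.condLaw_phi hR l h, H.condLaw_U hR]
  rfl

theorem follows_gamma (H : IsSeSVC μ Z U lam R) (hR : R (Set.Iic 0) = 0) {k l b a : V}
    (hkl : k ≠ l) (h : b ≠ a) :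
    Follows μ Z U lam R .gamma (.diff (.diff (.U k) (.diff (.Z b) (.Z a))) (.U l)) := by
  refine ⟨⟨k, l, b, a, hkl, h, rfl⟩,
    (H.condLaw_diff (by simpa [EVar.vars] using hkl.symm)).trans ?_⟩
  rw [H.condLaw_phi hR k h, H.condLaw_U hR]
  rfl

theorem ae_Z_ne_eval (H : IsSeSVC μ Z U lam R) {a : V} {W : EVar V} (h : Sum.inl a ∉ W.vars) :
    ∀ᵐ ω ∂μ, Z a ω ≠ W.eval (Z · ω) (U · ω) := by
  have hind : IndepFun (Z a) (fun ω => W.eval (Z · ω) (U · ω)) μ :=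
    (IndepFun_iff_Indep _ _ _).2 <| indep_of_indep_of_le_left
      (indep_of_indep_of_le_right (H.indep_sigmaVars (Set.disjoint_singleton_left.2 h))
        (W.measurable_eval (measurable_sigmaVars Z U)).comap_le)
      (measurable_sigmaVars Z U _ (Set.mem_singleton (Sum.inl a))).comap_le
  have : NullSingletonClass (μ.map (Z a)) := H.law_Z a ▸ nullSingletonClass_expMeasure lam
  exact ae_ne_of_indepFun (H.measurable_Z a) (H.measurable_eval W) hind

end IsSeSVC

/-- Outcomes without coincidences: sojourn times and recruitment durations are positive, and the
departures and completions of recruitments which are due to departures of different vehicles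
occur at different times. -/
structure Generic {V : Type*} (z u : V → ℝ) : Prop where
  pos_z : ∀ c, 0 < z c
  pos_u : ∀ c, 0 < u c
  z_ne_z : ∀ a b, a ≠ b → z a ≠ z b
  z_ne_z_add_u : ∀ a b c, a ≠ b → z a ≠ z b + u c
  z_add_u_ne_z_add_u : ∀ a b c d, a ≠ b → z a + u c ≠ z b + u d

theorem IsSeSVC.ae_generic {Ω V : Type*} [Countable V] [MeasurableSpace Ω] {μ : Measure Ω}
    [IsProbabilityMeasure μ] {Z U : V → Ω → ℝ} {lam : ℝ} {R : Measure ℝ}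
    (H : IsSeSVC μ Z U lam R) (hR : R (Set.Iic 0) = 0) :
    ∀ᵐ ω ∂μ, Generic (Z · ω) (U · ω) := by
  have hzz : ∀ᵐ ω ∂μ, ∀ a b, a ≠ b → Z a ω ≠ Z b ω := by
    simp only [ae_all_iff]
    exact fun a b h => H.ae_Z_ne_eval (W := .Z b) (by simpa [EVar.vars] using h)
  have hzu : ∀ᵐ ω ∂μ, ∀ a b c, a ≠ b → Z a ω ≠ Z b ω + U c ω := by
    simp only [ae_all_iff]
    exact fun a b c h => H.ae_Z_ne_eval (W := .sum (.Z b) (.U c)) (by simpa [EVar.vars] using h)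
  have huu : ∀ᵐ ω ∂μ, ∀ a b c d, a ≠ b → Z a ω ≠ Z b ω + U d ω - U c ω := by
    simp only [ae_all_iff]
    exact fun a b c d h => H.ae_Z_ne_eval (W := .diff (.sum (.Z b) (.U d)) (.U c))
      (by simpa [EVar.vars] using h)
  filter_upwards [ae_all_iff.2 H.ae_pos_Z, ae_all_iff.2 (H.ae_pos_U hR), hzz, hzu, huu]
    with ω hz hu hzz hzu huu
  exact ⟨hz, hu, hzz, hzu, fun a b c d h e => huu a b c d h (eq_sub_of_add_eq e)⟩

/-! ### The lists of an H-state -/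

/-- The vehicles in the lists of `S_{i,j}`: `vehicle k` processes a group, and `recruiter k` has
been recruiting since `departed k` left its group.  If `j ≠ 0`, the last event is the completion,
by `completer`, of the recruitment caused by the departure of `replaced`. -/
structure HLabels (V : Type*) (n i j : ℕ) where
  vehicle : Fin (2 * n - i) → V
  departed : Fin i → V
  recruiter : Fin i → V
  replaced : j ≠ 0 → V
  completer : j ≠ 0 → V

namespace HLabels

variable {V : Type*} {n i j : ℕ}

/-- The vehicle which has left its group last, among those not replaced yet. -/
def lastDeparted (L : HLabels V n i j) (hi : i ≠ 0) : V := L.departed ⟨i - 1, Nat.sub_one_lt hi⟩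

/-- The two lists of the H-state, with the vehicles they refer to. -/
def desc (L : HLabels V n i j) : HDesc V n i where
  vehicle := L.vehicle
  recruiter := L.recruiter
  sojourn k :=
    if hj : j = 0 then
      if hi : i = 0 then .Z (L.vehicle k)
      else .diff (.Z (L.vehicle k)) (.Z (L.lastDeparted hi))
    else .diff (.Z (L.vehicle k)) (.sum (.Z (L.replaced hj)) (.U (L.completer hj)))
  recruitment k :=
    if hj : j = 0 then
      if (k : ℕ) + 1 = i then .U (L.recruiter k)
      else .diff (.U (L.recruiter k)) (.diff (.Z (L.lastDeparted k.pos.ne')) (.Z (L.departed k)))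
    else if (k : ℕ) < j - 1 then
      .diff (.diff (.U (L.recruiter k)) (.diff (.Z (L.replaced hj)) (.Z (L.departed k))))
        (.U (L.completer hj))
    else
      .diff (.U (L.recruiter k))
        (.diff (.U (L.completer hj)) (.diff (.Z (L.departed k)) (.Z (L.replaced hj))))

/-- The time at which the H-state is entered. -/
def entryTime (L : HLabels V n i j) (z u : V → ℝ) : ℝ :=
  if hj : j = 0 then
    if hi : i = 0 then 0 else z (L.lastDeparted hi)
  else z (L.replaced hj) + u (L.completer hj)

theorem departed_eq_lastDeparted (L : HLabels V n i j) {k : Fin i} (hk : (k : ℕ) + 1 = i) :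
    L.departed k = L.lastDeparted k.pos.ne' :=
  congrArg L.departed (Fin.ext (Nat.eq_sub_of_add_eq hk))

section Evaluation

variable (L : HLabels V n i j) (z u : V → ℝ)

theorem eval_sojourn (k : Fin (2 * n - i)) :
    (L.desc.sojourn k).eval z u = z (L.vehicle k) - L.entryTime z u := by
  simp only [desc, entryTime]
  split_ifs <;> simp [EVar.eval]

theorem eval_recruitment (k : Fin i) :
    (L.desc.recruitment k).eval z u =
      z (L.departed k) + u (L.recruiter k) - L.entryTime z u := by
  simp only [desc, entryTime, k.pos.ne', dite_false]
  split_ifs with hj hk hk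
  · rw [L.departed_eq_lastDeparted hk, EVar.eval, add_sub_cancel_left]
  all_goals simp only [EVar.eval]; ring

theorem isDiff_recruitment_iff (k : Fin i) :
    (L.desc.recruitment k).IsDiff ↔ ¬ (j = 0 ∧ (k : ℕ) + 1 = i) := by
  simp only [desc]
  split_ifs <;> simp_all [EVar.IsDiff]

theorem duration_recruitment (k : Fin i) :
    (L.desc.recruitment k).duration = .U (L.recruiter k) := by
  simp only [desc]
  split_ifs <;> rfl

variable {L} in
theorem reducer_recruitment {k : Fin i} (h : (L.desc.recruitment k).IsDiff) :
    (L.desc.recruitment k).reducer z u = L.entryTime z u := by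
  rw [isDiff_recruitment_iff] at h
  simp only [desc, entryTime, k.pos.ne', dite_false]
  split_ifs with hj hk hk
  · exact absurd ⟨hj, hk⟩ h
  all_goals simp only [EVar.eval, EVar.reducer]; ring

variable {L} in
theorem pivot_recruitment {k : Fin i} (h : (L.desc.recruitment k).IsDiff) :
    (L.desc.recruitment k).pivot z u = z (L.departed k) := by
  rw [EVar.pivot, eval_recruitment, reducer_recruitment z u h, duration_recruitment, EVar.eval]
  ring

theorem pivLE_recruitment_iff (k l : Fin i) :
    EVar.PivLE z u (L.desc.recruitment k) (L.desc.recruitment l) ↔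
      ¬ (j = 0 ∧ (k : ℕ) + 1 = i) ∧ ((j = 0 ∧ (l : ℕ) + 1 = i) ∨
        (L.recruiter k ≠ L.recruiter l ∧ z (L.departed k) ≤ z (L.departed l))) := by
  have hl' : ¬ (L.desc.recruitment l).IsDiff ↔ j = 0 ∧ (l : ℕ) + 1 = i := by
    rw [isDiff_recruitment_iff, not_not]
  rw [EVar.PivLE, duration_recruitment, duration_recruitment, ne_eq, EVar.U.injEq,
    ← L.isDiff_recruitment_iff k, ← hl']
  by_cases hk : (L.desc.recruitment k).IsDiff <;> by_cases hl : (L.desc.recruitment l).IsDiff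
  · simp [hk, hl, pivot_recruitment z u hk, pivot_recruitment z u hl,
      reducer_recruitment z u hk, reducer_recruitment z u hl]
  all_goals simp [hk, hl]

end Evaluation

/-- Indices of the sojourn times which enter the lists of `S_{i,j}`. -/
abbrev SojournIndex (n i j : ℕ) : Type := Fin (2 * n - i) ⊕ Fin i ⊕ PLift (j ≠ 0)

/-- Indices of the recruitment durations which enter the lists of `S_{i,j}`. -/
abbrev DurationIndex (i j : ℕ) : Type := Fin i ⊕ PLift (j ≠ 0)

/-- The vehicles whose sojourn times enter the lists. -/
def sojournVehicle (L : HLabels V n i j) : SojournIndex n i j → V :=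
  Sum.elim L.vehicle (Sum.elim L.departed fun hj => L.replaced hj.down)

/-- The vehicles whose recruitment durations enter the lists. -/
def durationVehicle (L : HLabels V n i j) : DurationIndex i j → V :=
  Sum.elim L.recruiter fun hj => L.completer hj.down

/-- No sojourn time and no recruitment duration enters the lists in two different roles. -/
structure Distinct (L : HLabels V n i j) : Prop where
  sojournVehicle_inj : Function.Injective L.sojournVehicle
  durationVehicle_inj : Function.Injective L.durationVehicle

namespace Distinct

variable {L : HLabels V n i j} (hL : L.Distinct)

include hL

theorem vehicle_inj : Function.Injective L.vehicle :=
  hL.sojournVehicle_inj.comp Sum.inl_injective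

theorem departed_inj : Function.Injective L.departed :=
  hL.sojournVehicle_inj.comp (Sum.inr_injective.comp Sum.inl_injective)

theorem recruiter_inj : Function.Injective L.recruiter :=
  hL.durationVehicle_inj.comp Sum.inl_injective

theorem vehicle_ne_departed (k : Fin (2 * n - i)) (l : Fin i) : L.vehicle k ≠ L.departed l :=
  hL.sojournVehicle_inj.ne (a₁ := Sum.inl k) (a₂ := Sum.inr (Sum.inl l)) Sum.inl_ne_inr

theorem vehicle_ne_replaced (k : Fin (2 * n - i)) (hj : j ≠ 0) : L.vehicle k ≠ L.replaced hj :=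
  hL.sojournVehicle_inj.ne (a₁ := Sum.inl k) (a₂ := Sum.inr (Sum.inr ⟨hj⟩)) Sum.inl_ne_inr

theorem departed_ne_replaced (k : Fin i) (hj : j ≠ 0) : L.departed k ≠ L.replaced hj :=
  hL.sojournVehicle_inj.ne (a₁ := Sum.inr (Sum.inl k)) (a₂ := Sum.inr (Sum.inr ⟨hj⟩))
    (Sum.inr_injective.ne Sum.inl_ne_inr)

theorem recruiter_ne_completer (k : Fin i) (hj : j ≠ 0) : L.recruiter k ≠ L.completer hj :=
  hL.durationVehicle_inj.ne (a₁ := Sum.inl k) (a₂ := Sum.inr ⟨hj⟩) Sum.inl_ne_inr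

theorem pivLE_sojourn (hij : ¬ (i = 0 ∧ j = 0)) (z u : V → ℝ) {k l : Fin (2 * n - i)}
    (hkl : k ≠ l) : EVar.PivLE z u (L.desc.sojourn k) (L.desc.sojourn l) := by
  have hne : L.vehicle k ≠ L.vehicle l := hL.vehicle_inj.ne hkl
  right
  simp only [desc]
  split_ifs with hj hi
  · exact absurd ⟨hi, hj⟩ hij
  all_goals simp [EVar.IsDiff, EVar.duration, EVar.reducer, EVar.pivot, EVar.eval, hne]

end Distinct

/-- The conditions on the outcome under which the lists of the H-state describe the system: all
scheduled events lie in the future, and the recruiters are listed in the order of the departures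
that they make up for, the first `j - 1` of which precede the departure of `replaced`. -/
structure Admissible (L : HLabels V n i j) (z u : V → ℝ) : Prop where
  pos_z : ∀ c, 0 < z c
  pos_u : ∀ c, 0 < u c
  entryTime_lt_vehicle : ∀ k, L.entryTime z u < z (L.vehicle k)
  entryTime_lt_completion : ∀ k, L.entryTime z u < z (L.departed k) + u (L.recruiter k)
  strictMono_departed : StrictMono fun k => z (L.departed k)
  departed_lt_replaced : ∀ (hj : j ≠ 0) (k : Fin i), (k : ℕ) < j - 1 →
    z (L.departed k) < z (L.replaced hj)
  replaced_lt_departed : ∀ (hj : j ≠ 0) (k : Fin i), ¬ (k : ℕ) < j - 1 →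
    z (L.replaced hj) < z (L.departed k)
  departed_lt_entryTime : j ≠ 0 → ∀ k, z (L.departed k) < L.entryTime z u

namespace Admissible

variable {L : HLabels V n i j} {z u : V → ℝ}

theorem departed_le_entryTime (h : L.Admissible z u) (k : Fin i) :
    z (L.departed k) ≤ L.entryTime z u := by
  by_cases hj : j = 0
  · rw [entryTime, dif_pos hj, dif_neg k.pos.ne']
    exact h.strictMono_departed.monotone (Fin.le_def.2 (Nat.le_sub_one_of_lt k.2))
  · exact (h.departed_lt_entryTime hj k).le

theorem replaced_lt_entryTime (h : L.Admissible z u) (hj : j ≠ 0) :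
    z (L.replaced hj) < L.entryTime z u := by
  rw [entryTime, dif_neg hj]
  exact lt_add_of_pos_right _ (h.pos_u _)

theorem distinct (h : L.Admissible z u) (hv : Function.Injective L.vehicle)
    (hr : Function.Injective L.recruiter) (hc : ∀ k hj, L.recruiter k ≠ L.completer hj) :
    L.Distinct where
  sojournVehicle_inj := by
    have hz : ∀ {a b}, z a < z b → b ≠ a := fun hab e => hab.ne' (congrArg z e)
    refine hv.sumElim (Function.Injective.sumElim
      (fun k l e => h.strictMono_departed.injective (congrArg z e))
      (fun _ _ _ => Subsingleton.elim _ _) fun k hj => ?_) ?_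
    · by_cases hk : (k : ℕ) < j - 1
      · exact (hz (h.departed_lt_replaced hj.down k hk)).symm
      · exact hz (h.replaced_lt_departed hj.down k hk)
    · rintro k (l | hj)
      · exact hz ((h.departed_le_entryTime l).trans_lt (h.entryTime_lt_vehicle k))
      · exact hz ((h.replaced_lt_entryTime hj.down).trans (h.entryTime_lt_vehicle k))
  durationVehicle_inj :=
    hr.sumElim (fun _ _ _ => Subsingleton.elim _ _) fun k hj => hc k hj.down

theorem pivLE_recruitment_iff_lt (h : L.Admissible z u) (hr : Function.Injective L.recruiter)
    (k l : Fin i) :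
    EVar.PivLE z u (L.desc.recruitment k) (L.desc.recruitment l) ↔ k < l := by
  have hle : z (L.departed k) ≤ z (L.departed l) ↔ k ≤ l := h.strictMono_departed.le_iff_le
  rw [L.pivLE_recruitment_iff, hr.ne_iff, hle, Fin.lt_def, Fin.le_def, ne_eq, Fin.ext_iff]
  have hk := k.2
  have hl := l.2
  omega

theorem isEDVAt_sojourn (h : L.Admissible z u) (k : Fin (2 * n - i)) :
    (L.desc.sojourn k).IsEDVAt z u := by
  have hlt := h.entryTime_lt_vehicle k
  simp only [entryTime] at hlt
  simp only [desc]
  split_ifs <;> simp_all [EVar.IsEDVAt, EVar.eval, h.pos_z, h.pos_u]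

theorem isEDVAt_recruitment (h : L.Admissible z u) (k : Fin i) :
    (L.desc.recruitment k).IsEDVAt z u := by
  have hlt := h.entryTime_lt_completion k
  simp only [entryTime, k.pos.ne', dite_false] at hlt
  simp only [desc]
  split_ifs with hj hk hk <;> simp only [EVar.IsEDVAt, EVar.eval, h.pos_z, h.pos_u, true_and]
  · have hlast : z (L.departed k) < z (L.lastDeparted k.pos.ne') :=
      h.strictMono_departed (Fin.lt_def.2 (Nat.lt_sub_iff_add_lt.2 (lt_of_le_of_ne k.2 hk)))
    rw [dif_pos hj] at hlt
    constructor <;> linarith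
  · have hdep := h.departed_lt_replaced hj k hk
    rw [dif_neg hj] at hlt
    refine ⟨⟨hdep, ?_⟩, ?_⟩ <;> linarith [h.pos_u (L.completer hj)]
  · have hrep := h.replaced_lt_departed hj k hk
    have hent := h.departed_lt_entryTime hj k
    rw [entryTime, dif_neg hj] at hent
    rw [dif_neg hj] at hlt
    refine ⟨⟨hrep, ?_⟩, ?_⟩ <;> linarith

theorem relations (h : L.Admissible z u) (hr : Function.Injective L.recruiter) :
    L.desc.Relations z u :=
  ⟨h.isEDVAt_sojourn, h.isEDVAt_recruitment, fun k l => (h.pivLE_recruitment_iff_lt hr k l).2⟩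

theorem order_eq (h : L.Admissible z u) (hr : Function.Injective L.recruiter) (k : Fin i) :
    L.desc.order z u k = k + 1 := by
  have hIio : {l : Fin i | l ≠ k ∧ EVar.PivLE z u (L.desc.recruitment l) (L.desc.recruitment k)} =
      (Finset.Iio k : Finset (Fin i)) := by
    ext l
    simpa [h.pivLE_recruitment_iff_lt hr] using fun e : l < k => e.ne
  rw [HDesc.order, hIio, Set.ncard_coe_finset, Fin.card_Iio]

end Admissible

section IsHState

variable {Ω : Type*} [MeasurableSpace Ω] {μ : Measure Ω} [IsProbabilityMeasure μ]
  {Z U : V → Ω → ℝ} {lam : ℝ} {R : Measure ℝ} {L : HLabels V n i j} {ω : Ω}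

theorem isHEDL_phi (H : IsSeSVC μ Z U lam R) (hR : R (Set.Iic 0) = 0) (hL : L.Distinct)
    (h : L.Admissible (Z · ω) (U · ω)) (hj : j = 0) (hi : i ≠ 0) :
    IsHEDL μ Z U lam R ω .phi .recr (i - 1) 1 L.desc.recruitment := by
  refine ⟨(Nat.sub_one_add_one hi).symm, h.isEDVAt_recruitment, fun k hk => ?_, fun k hk => ?_,
    (h.relations hL.recruiter_inj).2.2⟩
  · have hk' : (k : ℕ) + 1 ≠ i := by omega
    simp only [desc, hj, hk', dite_true, if_false]
    refine H.follows_phi hR _ (hL.departed_inj.ne fun e => hk.ne ?_)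
    exact (congrArg Fin.val e).symm
  · have hk' : (k : ℕ) + 1 = i := by have := k.2; omega
    simp only [desc, hj, hk', dite_true, if_true]
    exact H.follows_recr hR _

theorem isHEDL_gamma (H : IsSeSVC μ Z U lam R) (hR : R (Set.Iic 0) = 0) (hL : L.Distinct)
    (h : L.Admissible (Z · ω) (U · ω)) (hj : j ≠ 0) (hji : j - 1 ≤ i) :
    IsHEDL μ Z U lam R ω .gamma .psi (j - 1) (i - (j - 1)) L.desc.recruitment := by
  refine ⟨(Nat.add_sub_cancel' hji).symm, h.isEDVAt_recruitment, fun k hk => ?_, fun k hk => ?_,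
    (h.relations hL.recruiter_inj).2.2⟩
  · simp only [desc, hj, hk, dite_false, if_true]
    exact H.follows_gamma hR (hL.recruiter_ne_completer _ _) (hL.departed_ne_replaced _ _).symm
  · simp only [desc, hj, not_lt.2 hk, dite_false, if_false]
    exact H.follows_psi hR (hL.recruiter_ne_completer _ _) (hL.departed_ne_replaced _ _)

theorem isHState (H : IsSeSVC μ Z U lam R) (hR : R (Set.Iic 0) = 0) (hL : L.Distinct)
    (h : L.Admissible (Z · ω) (U · ω)) (hji : j - 1 ≤ i) :
    L.desc.IsHState μ Z U lam R ω j := by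
  rw [HDesc.IsHState]
  split_ifs with hj hi
  · intro k
    simp only [desc, hj, hi, dite_true]
  · refine ⟨⟨fun k => ⟨h.isEDVAt_sojourn k, ?_⟩, fun k l hkl =>
      hL.pivLE_sojourn (by tauto) _ _ hkl.ne⟩, isHEDL_phi H hR hL h hj hi⟩
    simp only [desc, hj, hi, dite_true, dite_false]
    exact H.follows_expDot (hL.vehicle_ne_departed _ _)
  · refine ⟨⟨fun k => ⟨h.isEDVAt_sojourn k, ?_⟩, fun k l hkl =>
      hL.pivLE_sojourn (by tauto) _ _ hkl.ne⟩, isHEDL_gamma H hR hL h hj hji⟩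
    simp only [desc, hj, dite_false]
    exact H.follows_expDDot hR (hL.vehicle_ne_replaced _ _) _

end IsHState

section Law

variable {L : HLabels V n i j} {V' : Type*} {L' : HLabels V' n i j} {z u : V → ℝ} {z' u' : V' → ℝ}

theorem entryTime_congr (hz : ∀ x, z' (L'.sojournVehicle x) = z (L.sojournVehicle x))
    (hu : ∀ x, u' (L'.durationVehicle x) = u (L.durationVehicle x)) :
    L'.entryTime z' u' = L.entryTime z u := by
  have hdep : ∀ k, z' (L'.departed k) = z (L.departed k) := fun k => hz (.inr (.inl k))
  have hrep : ∀ hj, z' (L'.replaced hj) = z (L.replaced hj) := fun hj => hz (.inr (.inr ⟨hj⟩))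
  have hcom : ∀ hj, u' (L'.completer hj) = u (L.completer hj) := fun hj => hu (.inr ⟨hj⟩)
  simp only [entryTime, lastDeparted, hdep, hrep, hcom]

theorem values_congr (hz : ∀ x, z' (L'.sojournVehicle x) = z (L.sojournVehicle x))
    (hu : ∀ x, u' (L'.durationVehicle x) = u (L.durationVehicle x)) :
    L'.desc.values z' u' = L.desc.values z u := by
  have hveh : ∀ k, z' (L'.vehicle k) = z (L.vehicle k) := fun k => hz (.inl k)
  have hdep : ∀ k, z' (L'.departed k) = z (L.departed k) := fun k => hz (.inr (.inl k))
  have hrec : ∀ k, u' (L'.recruiter k) = u (L.recruiter k) := fun k => hu (.inl k)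
  simp only [HDesc.values, eval_sojourn, eval_recruitment, hveh, hdep, hrec, entryTime_congr hz hu]

theorem relations_congr (hL : Function.Injective L.recruiter)
    (hL' : Function.Injective L'.recruiter)
    (hz : ∀ x, z' (L'.sojournVehicle x) = z (L.sojournVehicle x))
    (hu : ∀ x, u' (L'.durationVehicle x) = u (L.durationVehicle x)) :
    L'.desc.Relations z' u' ↔ L.desc.Relations z u := by
  have hveh : ∀ k, z' (L'.vehicle k) = z (L.vehicle k) := fun k => hz (.inl k)
  have hdep : ∀ k, z' (L'.departed k) = z (L.departed k) := fun k => hz (.inr (.inl k))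
  have hrep : ∀ hj, z' (L'.replaced hj) = z (L.replaced hj) := fun hj => hz (.inr (.inr ⟨hj⟩))
  have hrec : ∀ k, u' (L'.recruiter k) = u (L.recruiter k) := fun k => hu (.inl k)
  have hcom : ∀ hj, u' (L'.completer hj) = u (L.completer hj) := fun hj => hu (.inr ⟨hj⟩)
  refine and_congr (forall_congr' fun k => ?_) (and_congr (forall_congr' fun k => ?_)
    (forall₂_congr fun k l => ?_))
  · simp only [desc, lastDeparted]
    split_ifs <;> simp only [EVar.IsEDVAt, EVar.eval, hveh, hdep, hrep, hcom]
  · simp only [desc, lastDeparted]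
    split_ifs <;> simp only [EVar.IsEDVAt, EVar.eval, hrec, hdep, hrep, hcom]
  · rw [pivLE_recruitment_iff, pivLE_recruitment_iff, hdep, hdep, hL.ne_iff, hL'.ne_iff]

/-- The labels of `S_{i,j}` in which each vehicle occurs in one role only; their joint law is the
law of all labels of `S_{i,j}`. -/
def canonical (n i j : ℕ) : HLabels (SojournIndex n i j ⊕ DurationIndex i j) n i j where
  vehicle k := .inl (.inl k)
  departed k := .inl (.inr (.inl k))
  recruiter k := .inr (.inl k)
  replaced hj := .inl (.inr (.inr ⟨hj⟩))
  completer hj := .inr (.inr ⟨hj⟩)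

theorem sojournVehicle_canonical (n i j : ℕ) : (canonical n i j).sojournVehicle = Sum.inl := by
  ext (k | k | hj) <;> rfl

theorem durationVehicle_canonical (n i j : ℕ) : (canonical n i j).durationVehicle = Sum.inr := by
  ext (k | hj) <;> rfl

theorem distinct_canonical (n i j : ℕ) : (canonical n i j).Distinct :=
  ⟨sojournVehicle_canonical n i j ▸ Sum.inl_injective,
    durationVehicle_canonical n i j ▸ Sum.inr_injective⟩

end Law

end HLabels

/-- The joint law of independent sojourn times (indexed by `A`) and recruitment durations (indexed
by `B`). -/
noncomputable def coordLaw (lam : ℝ) (R : Measure ℝ) (A B : Type*) [Fintype A] [Fintype B] :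
    Measure (A ⊕ B → ℝ) :=
  Measure.pi (Sum.elim (fun _ : A => expMeasure lam) fun _ : B => R)

/-- The law `ν_{i,j}` of the lists of `S_{i,j}` given their defining relations. -/
noncomputable def hLaw (n : ℕ) (lam : ℝ) (R : Measure ℝ) (i j : ℕ) : Measure (Residuals n i) :=
  (HLabels.canonical n i j).desc.jointLaw
    (coordLaw lam R (HLabels.SojournIndex n i j) (HLabels.DurationIndex i j))
    (fun c p => p c) fun c p => p c

theorem IsSeSVC.map_eq_coordLaw {Ω V A B : Type*} [Fintype A] [Fintype B] [MeasurableSpace Ω]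
    {μ : Measure Ω} [IsProbabilityMeasure μ] {Z U : V → Ω → ℝ} {lam : ℝ} {R : Measure ℝ}
    (H : IsSeSVC μ Z U lam R) {f : A → V} {g : B → V} (hf : Function.Injective f)
    (hg : Function.Injective g) :
    μ.map (fun ω x => Sum.elim Z U (Sum.map f g x) ω) = coordLaw lam R A B := by
  have hind := H.indep.precomp (Sum.map_injective.2 ⟨hf, hg⟩)
  refine ((iIndepFun_iff_map_fun_eq_pi_map fun x => (H.measurable_elim _).aemeasurable).1
    hind).trans (congrArg Measure.pi (funext fun x => ?_))
  cases x with
  | inl a => exact H.law_Z _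
  | inr b => exact H.law_U _

section Measurability

variable {Ω V : Type*} [MeasurableSpace Ω] {Z U : V → Ω → ℝ} {n i j : ℕ}

theorem HDesc.measurable_values (hm : ∀ x, Measurable (Sum.elim Z U x)) (d : HDesc V n i) :
    Measurable fun ω => d.values (Z · ω) (U · ω) :=
  (measurable_pi_lambda _ fun k => (d.sojourn k).measurable_eval fun x _ => hm x).prodMk
    (measurable_pi_lambda _ fun k => (d.recruitment k).measurable_eval fun x _ => hm x)

theorem HLabels.measurableSet_relations (hm : ∀ x, Measurable (Sum.elim Z U x))
    (L : HLabels V n i j) : MeasurableSet {ω | L.desc.Relations (Z · ω) (U · ω)} := by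
  have hpivLE : ∀ k l, MeasurableSet {ω | EVar.PivLE (Z · ω) (U · ω) (L.desc.recruitment k)
      (L.desc.recruitment l)} := fun k l => by
    have hle := measurableSet_le (hm (Sum.inl (L.departed k))) (hm (Sum.inl (L.departed l)))
    simp only [HLabels.pivLE_recruitment_iff]
    exact (MeasurableSet.const _).inter
      ((MeasurableSet.const _).union ((MeasurableSet.const _).inter hle))
  simp only [HDesc.Relations, Set.ofPred_and, Set.ofPred_forall]
  exact (MeasurableSet.iInter fun k => EVar.measurableSet_isEDVAt _ fun x _ => hm x).inter
    ((MeasurableSet.iInter fun k => EVar.measurableSet_isEDVAt _ fun x _ => hm x).inter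
      (.iInter fun k => .iInter fun l => .iInter fun _ => hpivLE k l))

end Measurability

theorem HLabels.Distinct.jointLaw_eq {Ω V : Type*} [MeasurableSpace Ω] {μ : Measure Ω}
    [IsProbabilityMeasure μ] {Z U : V → Ω → ℝ} {lam : ℝ} {R : Measure ℝ} {n i j : ℕ}
    {L : HLabels V n i j} (hL : L.Distinct) (H : IsSeSVC μ Z U lam R) :
    L.desc.jointLaw μ Z U = hLaw n lam R i j := by
  let coord ω x := Sum.elim Z U (Sum.map L.sojournVehicle L.durationVehicle x) ω
  have hcoord : Measurable coord := measurable_pi_lambda _ fun x => H.measurable_elim _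
  have hz : ∀ ω x, Z (L.sojournVehicle x) ω =
      coord ω ((HLabels.canonical n i j).sojournVehicle x) := fun ω x => by
    rw [HLabels.sojournVehicle_canonical]; rfl
  have hu : ∀ ω x, U (L.durationVehicle x) ω =
      coord ω ((HLabels.canonical n i j).durationVehicle x) := fun ω x => by
    rw [HLabels.durationVehicle_canonical]; rfl
  have hm : ∀ x, Measurable (Sum.elim
      (fun c (p : HLabels.SojournIndex n i j ⊕ HLabels.DurationIndex i j → ℝ) => p c)
      (fun c p => p c) x) := by
    rintro (x | x) <;> exact measurable_pi_apply x
  rw [hLaw, HDesc.jointLaw, HDesc.jointLaw,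
    ← H.map_eq_coordLaw hL.sojournVehicle_inj hL.durationVehicle_inj,
    ← map_cond_preimage hcoord (HLabels.measurableSet_relations hm _),
    Measure.map_map (HDesc.measurable_values hm _) hcoord]
  congr 1
  · exact funext fun ω => HLabels.values_congr (hz ω) (hu ω)
  · congr 1
    ext ω
    exact HLabels.relations_congr (HLabels.distinct_canonical n i j).recruiter_inj
      hL.recruiter_inj (hz ω) (hu ω)

namespace HLabels

variable {V : Type*} {n i j : ℕ} {L : HLabels V n i j}

/-- The events scheduled in the H-state, one for each entry of the two lists. -/
def event (L : HLabels V n i j) : Fin (2 * n - i) ⊕ Fin i → VCEvent V :=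
  Sum.elim (fun k => .depart (L.vehicle k)) fun k => .recruit (L.recruiter k)

/-- The times of the events scheduled in the H-state. -/
def eventTime (L : HLabels V n i j) (z u : V → ℝ) : Fin (2 * n - i) ⊕ Fin i → ℝ :=
  Sum.elim (fun k => z (L.vehicle k)) fun k => z (L.departed k) + u (L.recruiter k)

theorem elim_values (L : HLabels V n i j) (z u : V → ℝ) (x : Fin (2 * n - i) ⊕ Fin i) :
    Sum.elim (L.desc.values z u).1 (L.desc.values z u).2 x =
      L.eventTime z u x - L.entryTime z u := by
  cases x with
  | inl k => exact L.eval_sojourn z u k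
  | inr k => exact L.eval_recruitment z u k

theorem Distinct.eventTime_injective (hL : L.Distinct) {z u : V → ℝ} (hg : Generic z u) :
    Function.Injective (L.eventTime z u) := by
  refine Function.Injective.sumElim (fun k l e => ?_) (fun k l e => ?_) fun k l =>
    hg.z_ne_z_add_u _ _ _ (hL.vehicle_ne_departed k l)
  · exact hL.vehicle_inj (not_imp_not.1 (hg.z_ne_z _ _) e)
  · exact hL.departed_inj (not_imp_not.1 (hg.z_add_u_ne_z_add_u _ _ _ _) e)

end HLabels

theorem rel_of_mem_erase_of_pairwise {α : Type*} [BEq α] [LawfulBEq α] {r : α → α → Prop}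
    {l : List α} {a : α} (h : l.Pairwise r) (ha : a ∈ l) :
    (∀ b ∈ (l.erase a).take (l.idxOf a), r b a) ∧ ∀ b ∈ (l.erase a).drop (l.idxOf a), r a b := by
  obtain ⟨l₁, l₂, hl₁, rfl, he⟩ := List.exists_erase_eq ha
  have hidx : (l₁ ++ a :: l₂).idxOf a = l₁.length := by
    rw [List.idxOf_append_of_notMem hl₁, List.idxOf_cons_self, add_zero]
  obtain ⟨-, hr₂, hr⟩ := List.pairwise_append.1 h
  rw [he, hidx, List.take_left, List.drop_left]
  exact ⟨fun b hb => hr b hb a List.mem_cons_self, (List.pairwise_cons.1 hr₂).1⟩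

/-! ### Histories and configurations -/

/-- The places for vehicles: two at each of the `n` groups. -/
abbrev Slot (n : ℕ) : Type := Fin n × Fin 2

namespace Slot

variable {n : ℕ}

/-- The other place at the same group. -/
def partner (p : Slot n) : Slot n := (p.1, p.2.rev)

theorem partner_partner (p : Slot n) : p.partner.partner = p :=
  Prod.ext rfl p.2.rev_rev

theorem partner_injective : Function.Injective (partner (n := n)) :=
  Function.LeftInverse.injective partner_partner

theorem partner_ne (p : Slot n) : p.partner ≠ p := by
  obtain ⟨g, b⟩ := p
  fin_cases b <;> simp [partner]

theorem eq_or_eq_partner {p q : Slot n} (h : p.1 = q.1) : p = q ∨ p = q.partner := by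
  obtain ⟨g, b⟩ := p
  obtain ⟨g', b'⟩ := q
  obtain rfl : g = g' := h
  fin_cases b <;> fin_cases b' <;> simp [partner]

end Slot

/-- The part of the history that determines the two lists: `occupant p` is the last vehicle that
came to place `p`, the places in `vacant` have been left, in this order, and their partners are
recruiting.  After the completion of a recruitment by `completer`, for the place left by `replaced`,
`order` is the order which this recruiter had; otherwise `order` is `0`. -/
structure SymConfig (V : Type*) (n : ℕ) where
  occupant : Slot n ↪ V
  vacant : List (Slot n)
  order : ℕ
  replaced : order ≠ 0 → V
  completer : order ≠ 0 → V
  nodup_groups : (vacant.map Prod.fst).Nodup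
  order_le : order ≤ vacant.length + 1
  length_lt : order ≠ 0 → vacant.length < n
  occupant_ne_completer : ∀ p ∈ vacant, ∀ h, occupant p.partner ≠ completer h

namespace SymConfig

variable {V : Type*} {n : ℕ}

/-- The initial configuration. -/
def initial (alloc : Fin n → Fin 2 → V) (ha : Function.Injective (Function.uncurry alloc)) :
    SymConfig V n where
  occupant := ⟨Function.uncurry alloc, ha⟩
  vacant := []
  order := 0
  replaced h := absurd rfl h
  completer h := absurd rfl h
  nodup_groups := List.nodup_nil
  order_le := Nat.zero_le _
  length_lt h := absurd rfl h
  occupant_ne_completer _ _ h := absurd rfl h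

section Vacant

variable (S : SymConfig V n) {p q : Slot n}

theorem nodup_vacant : S.vacant.Nodup := S.nodup_groups.of_map

theorem length_vacant_le : S.vacant.length ≤ n := by
  simpa using S.nodup_groups.length_le_card

variable {S}

theorem notMem_vacant_of_fst (hp : p.1 ∉ S.vacant.map Prod.fst) : p ∉ S.vacant := fun h =>
  hp (List.mem_map_of_mem h)

theorem eq_of_mem_vacant (hp : p ∈ S.vacant) (hq : q ∈ S.vacant) (h : p.1 = q.1) : p = q :=
  List.inj_on_of_nodup_map S.nodup_groups hp hq h

theorem partner_notMem_vacant (hp : p ∈ S.vacant) : p.partner ∉ S.vacant := fun h =>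
  p.partner_ne (eq_of_mem_vacant h hp rfl)

theorem notMem_vacant_iff :
    p ∉ S.vacant ↔ p.partner ∈ S.vacant ∨ p.1 ∉ S.vacant.map Prod.fst := by
  refine ⟨fun hp => or_iff_not_imp_right.2 fun hg => ?_, ?_⟩
  · obtain ⟨q, hq, hqp⟩ := List.mem_map.1 (not_not.1 hg)
    rcases Slot.eq_or_eq_partner hqp with rfl | rfl
    exacts [absurd hq hp, hq]
  · rintro (hp | hp)
    · exact p.partner_partner ▸ partner_notMem_vacant hp
    · exact notMem_vacant_of_fst hp

end Vacant

/-- The configuration after the departure of the vehicle at place `p` of a group processed by two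
vehicles. -/
def depart (S : SymConfig V n) (p : Slot n) (hp : p.1 ∉ S.vacant.map Prod.fst) :
    SymConfig V n where
  occupant := S.occupant
  vacant := S.vacant ++ [p]
  order := 0
  replaced h := absurd rfl h
  completer h := absurd rfl h
  nodup_groups := by
    rw [List.map_append]
    exact S.nodup_groups.append (List.nodup_singleton _) (List.disjoint_singleton.2 hp)
  order_le := Nat.zero_le _
  length_lt h := absurd rfl h
  occupant_ne_completer _ _ h := absurd rfl h

open Classical in
/-- The configuration after the assignment of `y` to the vacant place `p`. -/
noncomputable def recruit (S : SymConfig V n) (p : Slot n) (hp : p ∈ S.vacant) (y : V) :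
    SymConfig V n where
  occupant := S.occupant.setValue p y
  vacant := S.vacant.erase p
  order := S.vacant.idxOf p + 1
  replaced _ := S.occupant p
  completer _ := S.occupant p.partner
  nodup_groups := S.nodup_groups.sublist (List.erase_sublist.map _)
  order_le := by
    have := List.idxOf_lt_length_iff.2 hp
    rw [List.length_erase_of_mem hp]
    omega
  length_lt _ := by
    have := List.length_pos_of_mem hp
    have := S.length_vacant_le
    rw [List.length_erase_of_mem hp]
    omega
  occupant_ne_completer q hq _ := by
    have hqp : q ≠ p ∧ q ∈ S.vacant := S.nodup_vacant.mem_erase_iff.1 hq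
    have hne : q.partner ≠ p := fun e => partner_notMem_vacant hqp.2 (e ▸ hp)
    simp only [Function.Embedding.setValue, Function.Embedding.coeFn_mk, hne, if_false]
    split_ifs
    · exact S.occupant.injective.ne p.partner_ne.symm
    · exact S.occupant.injective.ne (Slot.partner_injective.ne hqp.1)

open Classical in
/-- The configuration after the given move; moves which cannot occur are ignored. -/
noncomputable def next (S : SymConfig V n) : Move V → SymConfig V n
  | .depart c =>
    if h : ∃ p : Slot n, p.1 ∉ S.vacant.map Prod.fst ∧ S.occupant p = c then
      S.depart h.choose h.choose_spec.1
    else S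
  | .recruit c y =>
    if h : ∃ p ∈ S.vacant, S.occupant p.partner = c then S.recruit h.choose h.choose_spec.1 y
    else S

theorem next_depart (S : SymConfig V n) {p : Slot n} (hp : p.1 ∉ S.vacant.map Prod.fst) :
    S.next (.depart (S.occupant p)) = S.depart p hp := by
  have h : ∃ q : Slot n, q.1 ∉ S.vacant.map Prod.fst ∧ S.occupant q = S.occupant p := ⟨p, hp, rfl⟩
  rw [next, dif_pos h]
  congr 1
  exact S.occupant.injective h.choose_spec.2

theorem next_recruit (S : SymConfig V n) {p : Slot n} (hp : p ∈ S.vacant) (y : V) :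
    S.next (.recruit (S.occupant p.partner) y) = S.recruit p hp y := by
  have h : ∃ q ∈ S.vacant, S.occupant q.partner = S.occupant p.partner := ⟨p, hp, rfl⟩
  rw [next, dif_pos h]
  congr 1
  exact Slot.partner_injective (S.occupant.injective h.choose_spec.2)

/-- The configuration after a history. -/
noncomputable def after (S : SymConfig V n) (h : List (Move V)) : SymConfig V n := h.foldl next S

theorem after_concat (S : SymConfig V n) (h : List (Move V)) (m : Move V) :
    S.after (h ++ [m]) = (S.after h).next m :=
  List.foldl_concat next S m h

/-- The indices of the H-state. -/
def hState (S : SymConfig V n) : ℕ × ℕ := (S.vacant.length, S.order)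

theorem hState_mem_hStates (S : SymConfig V n) : S.hState ∈ hStates n S.vacant.length := by
  rw [hState, hStates]
  split_ifs with hlt
  · exact Finset.mem_image_of_mem _ (Finset.mem_range.2 (Nat.lt_succ_of_le S.order_le))
  · rw [Finset.mem_singleton, Prod.mk.injEq]
    exact ⟨S.length_vacant_le.antisymm (not_lt.1 hlt), not_not.1 fun h => hlt (S.length_lt h)⟩

/-- The occupied places, those of the recruiters first. -/
noncomputable def slots (S : SymConfig V n) : List (Slot n) :=
  S.vacant.map Slot.partner ++
    (Finset.univ.filter fun p : Slot n => p.1 ∉ S.vacant.map Prod.fst).toList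

theorem mem_slots {S : SymConfig V n} {p : Slot n} : p ∈ S.slots ↔ p ∉ S.vacant := by
  have hpartner : p ∈ S.vacant.map Slot.partner ↔ p.partner ∈ S.vacant := by
    rw [← p.partner_partner, List.mem_map_of_injective Slot.partner_injective, p.partner_partner]
  rw [slots, List.mem_append, hpartner, Finset.mem_toList, Finset.mem_filter, notMem_vacant_iff]
  simp only [Finset.mem_univ, true_and]

theorem nodup_slots (S : SymConfig V n) : S.slots.Nodup := by
  refine (S.nodup_vacant.map Slot.partner_injective).append (Finset.nodup_toList _) ?_
  intro _ hp hpair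
  obtain ⟨q, hq, rfl⟩ := List.mem_map.1 hp
  exact (Finset.mem_filter.1 (Finset.mem_toList.1 hpair)).2 (List.mem_map.2 ⟨q, hq, rfl⟩)

theorem length_slots (S : SymConfig V n) : S.slots.length = 2 * n - S.vacant.length := by
  have hcompl : S.slots.toFinset = S.vacant.toFinsetᶜ := by
    ext p
    simp [mem_slots]
  rw [← List.toFinset_card_of_nodup S.nodup_slots, hcompl, Finset.card_compl,
    List.toFinset_card_of_nodup S.nodup_vacant, Fintype.card_prod, Fintype.card_fin,
    Fintype.card_fin, mul_comm]

/-- The vehicles in the lists of the H-state. -/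
noncomputable def labels (S : SymConfig V n) : HLabels V n S.vacant.length S.order where
  vehicle k := S.occupant (S.slots.get (k.cast S.length_slots.symm))
  departed k := S.occupant (S.vacant.get k)
  recruiter k := S.occupant (S.vacant.get k).partner
  replaced := S.replaced
  completer := S.completer

theorem vehicle_injective (S : SymConfig V n) : Function.Injective S.labels.vehicle :=
  S.occupant.injective.comp (S.nodup_slots.injective_get.comp (Fin.cast_injective _))

theorem recruiter_injective (S : SymConfig V n) : Function.Injective S.labels.recruiter :=
  S.occupant.injective.comp (Slot.partner_injective.comp S.nodup_vacant.injective_get)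

theorem exists_vehicle_iff (S : SymConfig V n) (c : V) :
    (∃ k, S.labels.vehicle k = c) ↔ ∃ p ∉ S.vacant, S.occupant p = c := by
  constructor
  · rintro ⟨k, rfl⟩
    exact ⟨_, mem_slots.1 (List.get_mem _ _), rfl⟩
  · rintro ⟨p, hp, rfl⟩
    obtain ⟨k, rfl⟩ := List.get_of_mem (mem_slots.2 hp)
    exact ⟨k.cast S.length_slots, rfl⟩

theorem exists_recruiter_iff (S : SymConfig V n) (c : V) :
    (∃ k, S.labels.recruiter k = c) ↔ ∃ p ∈ S.vacant, S.occupant p.partner = c := by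
  simp only [List.mem_iff_get, labels]
  exact ⟨fun ⟨k, hk⟩ => ⟨_, ⟨k, rfl⟩, hk⟩, fun ⟨_, ⟨k, hk⟩, hc⟩ => ⟨k, hk ▸ hc⟩⟩

theorem vehicle_eq_recruiter (S : SymConfig V n) {k : Fin (2 * n - S.vacant.length)}
    {l : Fin S.vacant.length} (h : (k : ℕ) = l) : S.labels.vehicle k = S.labels.recruiter l := by
  obtain ⟨k, hk⟩ := k
  obtain rfl : k = l := h
  have hget : S.slots.get ⟨l, S.length_slots.symm ▸ hk⟩ = (S.vacant.get l).partner := by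
    simp only [slots, List.get_eq_getElem]
    rw [List.getElem_append_left (by simp), List.getElem_map]
  exact congrArg S.occupant hget

theorem hState_next_depart (S : SymConfig V n) {p : Slot n} (hp : p.1 ∉ S.vacant.map Prod.fst) :
    (S.next (.depart (S.occupant p))).hState = (S.vacant.length + 1, 0) := by
  rw [next_depart S hp, hState, depart, List.length_append, List.length_singleton]

theorem hState_next_recruit (S : SymConfig V n) (k : Fin S.vacant.length) (y : V) :
    (S.next (.recruit (S.labels.recruiter k) y)).hState = (S.vacant.length - 1, (k : ℕ) + 1) := by
  have hk : S.vacant.get k ∈ S.vacant := List.get_mem _ _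
  change (S.next (.recruit (S.occupant (S.vacant.get k).partner) y)).hState = _
  rw [next_recruit S hk]
  exact Prod.ext (List.length_erase_of_mem hk)
    (congrArg (· + 1) (S.nodup_vacant.idxOf_getElem k k.2))

theorem occupant_recruit_self (S : SymConfig V n) {p : Slot n} (hp : p ∈ S.vacant) (y : V) :
    (S.recruit p hp y).occupant p = y := by
  classical exact S.occupant.setValue_eq p y

theorem occupant_recruit_of_ne {S : SymConfig V n} {p q : Slot n} (hp : p ∈ S.vacant) {y : V}
    (hy : y ∉ Set.range S.occupant) (hq : q ≠ p) :
    (S.recruit p hp y).occupant q = S.occupant q := by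
  classical exact Function.Embedding.setValue_eq_of_ne hq fun e => hy ⟨q, e⟩

section EntryTime

variable (S : SymConfig V n) (z u : V → ℝ) {p : Slot n}

theorem entryTime_depart (hp : p.1 ∉ S.vacant.map Prod.fst) :
    (S.depart p hp).labels.entryTime z u = z (S.occupant p) := by
  simp [HLabels.entryTime, HLabels.lastDeparted, labels, depart]

theorem entryTime_recruit (hp : p ∈ S.vacant) (y : V) :
    (S.recruit p hp y).labels.entryTime z u = z (S.occupant p) + u (S.occupant p.partner) := by
  simp [HLabels.entryTime, labels, recruit]

end EntryTime

/-- At the outcome `(z, u)`, the departures and completions of the configuration happen in the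
order that it records, the last of them at time `labels.entryTime`. -/
structure Timely (S : SymConfig V n) (z u : V → ℝ) : Prop where
  sorted : S.vacant.Pairwise fun p q => z (S.occupant p) < z (S.occupant q)
  entryTime_lt_occupant : ∀ p ∉ S.vacant, S.labels.entryTime z u < z (S.occupant p)
  entryTime_lt_completion : ∀ p ∈ S.vacant,
    S.labels.entryTime z u < z (S.occupant p) + u (S.occupant p.partner)
  occupant_lt_replaced : ∀ hj, ∀ p ∈ S.vacant.take (S.order - 1),
    z (S.occupant p) < z (S.replaced hj)
  replaced_lt_occupant : ∀ hj, ∀ p ∈ S.vacant.drop (S.order - 1),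
    z (S.replaced hj) < z (S.occupant p)
  occupant_lt_entryTime : S.order ≠ 0 → ∀ p ∈ S.vacant,
    z (S.occupant p) < S.labels.entryTime z u

namespace Timely

variable {S : SymConfig V n} {z u : V → ℝ} {p : Slot n}

theorem admissible (h : S.Timely z u) (hz : ∀ c, 0 < z c) (hu : ∀ c, 0 < u c) :
    S.labels.Admissible z u where
  pos_z := hz
  pos_u := hu
  entryTime_lt_vehicle k := h.entryTime_lt_occupant _ (mem_slots.1 (List.get_mem _ _))
  entryTime_lt_completion k := h.entryTime_lt_completion _ (List.get_mem _ k)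
  strictMono_departed k l hkl := List.pairwise_iff_get.1 h.sorted k l hkl
  departed_lt_replaced hj k hk := h.occupant_lt_replaced hj _
    (List.mem_take_iff_getElem.2 ⟨k, lt_min hk k.2, rfl⟩)
  replaced_lt_departed hj k hk := h.replaced_lt_occupant hj _
    (List.mem_drop_iff_getElem.2 ⟨k - (S.order - 1), by omega, by
      simp [Nat.add_sub_cancel' (not_lt.1 hk)]⟩)
  departed_lt_entryTime hj k := h.occupant_lt_entryTime hj _ (List.get_mem _ k)

theorem occupant_le_entryTime (h : S.Timely z u) (hz : ∀ c, 0 < z c) (hu : ∀ c, 0 < u c)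
    (hp : p ∈ S.vacant) : z (S.occupant p) ≤ S.labels.entryTime z u := by
  obtain ⟨k, rfl⟩ := List.get_of_mem hp
  exact (h.admissible hz hu).departed_le_entryTime k

theorem depart (h : S.Timely z u) (hz : ∀ c, 0 < z c) (hu : ∀ c, 0 < u c)
    (hp : p.1 ∉ S.vacant.map Prod.fst)
    (hoccupant : ∀ q ∉ S.vacant, q ≠ p → z (S.occupant p) < z (S.occupant q))
    (hcompletion : ∀ q ∈ S.vacant,
      z (S.occupant p) < z (S.occupant q) + u (S.occupant q.partner)) :
    (S.depart p hp).Timely z u where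
  sorted := List.pairwise_append.2 ⟨h.sorted, List.pairwise_singleton _ _, fun q hq q' hq' => by
    obtain rfl := List.mem_singleton.1 hq'
    exact (h.occupant_le_entryTime hz hu hq).trans_lt
      (h.entryTime_lt_occupant q' (notMem_vacant_of_fst hp))⟩
  entryTime_lt_occupant q hq := by
    rw [entryTime_depart]
    simp only [SymConfig.depart, List.mem_append, List.mem_singleton, not_or] at hq
    exact hoccupant q hq.1 hq.2
  entryTime_lt_completion q hq := by
    rw [entryTime_depart]
    simp only [SymConfig.depart, List.mem_append, List.mem_singleton] at hq
    rcases hq with hq | rfl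
    exacts [hcompletion q hq, lt_add_of_pos_right _ (hu _)]
  occupant_lt_replaced hj := absurd rfl hj
  replaced_lt_occupant hj := absurd rfl hj
  occupant_lt_entryTime hj := absurd rfl hj

theorem recruit (h : S.Timely z u) (hz : ∀ c, 0 < z c) (hu : ∀ c, 0 < u c) (hp : p ∈ S.vacant)
    {y : V} (hy : y ∉ Set.range S.occupant)
    (hzy : z (S.occupant p) + u (S.occupant p.partner) < z y)
    (hoccupant : ∀ q ∉ S.vacant,
      z (S.occupant p) + u (S.occupant p.partner) < z (S.occupant q))
    (hcompletion : ∀ q ∈ S.vacant, q ≠ p → z (S.occupant p) + u (S.occupant p.partner) <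
      z (S.occupant q) + u (S.occupant q.partner)) :
    (S.recruit p hp y).Timely z u := by
  have hmem : ∀ {q}, q ∈ S.vacant.erase p ↔ q ≠ p ∧ q ∈ S.vacant := S.nodup_vacant.mem_erase_iff
  have hset : ∀ {q}, q ≠ p → (S.recruit p hp y).occupant q = S.occupant q :=
    occupant_recruit_of_ne hp hy
  have hset' : ∀ q ∈ S.vacant.erase p, (S.recruit p hp y).occupant q = S.occupant q :=
    fun q hq => hset (hmem.1 hq).1
  have herase := rel_of_mem_erase_of_pairwise h.sorted hp
  refine ⟨?_, fun q hq => ?_, fun q hq => ?_, fun _ q hq => ?_, fun _ q hq => ?_, fun _ q hq => ?_⟩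
  · refine (h.sorted.sublist List.erase_sublist).imp_of_mem fun {a b} ha hb hab => ?_
    exact (hset' a ha).symm ▸ (hset' b hb).symm ▸ hab
  · rw [entryTime_recruit]
    by_cases hqp : q = p
    · subst hqp
      exact (S.occupant_recruit_self hp y).symm ▸ hzy
    · exact (hset hqp).symm ▸ hoccupant q fun hq' => hq (hmem.2 ⟨hqp, hq'⟩)
  · rw [entryTime_recruit]
    have hqp : q.partner ≠ p := fun e => partner_notMem_vacant (hmem.1 hq).2 (e ▸ hp)
    exact (hset' q hq).symm ▸ (hset hqp).symm ▸ hcompletion q (hmem.1 hq).2 (hmem.1 hq).1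
  · exact (hset' q (List.mem_of_mem_take hq)).symm ▸ herase.1 q hq
  · exact (hset' q (List.mem_of_mem_drop hq)).symm ▸ herase.2 q hq
  · rw [entryTime_recruit]
    exact (hset' q hq).symm ▸ (h.occupant_le_entryTime hz hu (hmem.1 hq).2).trans_lt
      (h.entryTime_lt_completion p hp)

end Timely

/-- `S` records, at the outcome `(z, u)`, the configuration `X` of the system. -/
structure Matches (z u : V → ℝ) (S : SymConfig V n) (X : VCConfig V n) : Prop where
  timely : S.Timely z u
  time_eq : X.time = S.labels.entryTime z u
  status_single : ∀ p ∈ S.vacant, X.status p.1 = .single (S.occupant p.partner) (z (S.occupant p))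
  status_pair : ∀ p : Slot n, p.1 ∉ S.vacant.map Prod.fst →
    X.status p.1 = .pair (S.occupant p) (S.occupant p.partner) ∨
      X.status p.1 = .pair (S.occupant p.partner) (S.occupant p)

namespace Matches

variable {S : SymConfig V n} {X : VCConfig V n} {z u : V → ℝ} (h : S.Matches z u X) {p : Slot n}

include h

section Status

variable {g : Fin n} {c d : V} {s : ℝ}

theorem active_iff : X.Active c ↔ ∃ p ∉ S.vacant, S.occupant p = c := by
  constructor
  · rintro ⟨g, hc⟩
    by_cases hg : g ∈ S.vacant.map Prod.fst
    · obtain ⟨p, hp, rfl⟩ := List.mem_map.1 hg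
      rw [h.status_single p hp] at hc
      exact ⟨_, partner_notMem_vacant hp, hc.symm⟩
    · have hslot : ∀ b, (g, b) ∉ S.vacant := fun b => notMem_vacant_of_fst hg
      rcases h.status_pair (g, 0) hg with e | e <;> rw [e] at hc <;> rcases hc with rfl | rfl <;>
        exact ⟨_, hslot _, rfl⟩
  · rintro ⟨p, hp, rfl⟩
    refine ⟨p.1, ?_⟩
    rcases notMem_vacant_iff.1 hp with hq | hg
    · exact h.status_single _ hq ▸ congrArg S.occupant p.partner_partner.symm
    · rcases h.status_pair p hg with e | e <;> rw [e]
      exacts [Or.inl rfl, Or.inr rfl]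

theorem status_eq_single_iff : X.status g = .single c s ↔
    ∃ p ∈ S.vacant, p.1 = g ∧ S.occupant p.partner = c ∧ z (S.occupant p) = s := by
  constructor
  · intro hg
    by_cases hgv : g ∈ S.vacant.map Prod.fst
    · obtain ⟨p, hp, rfl⟩ := List.mem_map.1 hgv
      rw [h.status_single p hp] at hg
      exact ⟨p, hp, rfl, GroupStatus.single.inj hg⟩
    · rcases h.status_pair (g, 0) hgv with e | e <;> cases e.symm.trans hg
  · rintro ⟨p, hp, rfl, rfl, rfl⟩
    exact h.status_single p hp

theorem exists_occupant_of_pair (hg : X.status g = .pair c d ∨ X.status g = .pair d c) :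
    ∃ p : Slot n, p.1 ∉ S.vacant.map Prod.fst ∧ p.1 = g ∧ S.occupant p = c ∧
      S.occupant p.partner = d := by
  have hgv : g ∉ S.vacant.map Prod.fst := fun hgv => by
    obtain ⟨p, hp, rfl⟩ := List.mem_map.1 hgv
    rcases hg with e | e <;> cases (h.status_single p hp).symm.trans e
  have key : ∀ p : Slot n, p.1 = g → X.status g = .pair (S.occupant p) (S.occupant p.partner) →
      ∃ p : Slot n, p.1 ∉ S.vacant.map Prod.fst ∧ p.1 = g ∧ S.occupant p = c ∧
        S.occupant p.partner = d := by
    rintro p rfl e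
    rcases hg with e' | e' <;> cases e.symm.trans e'
    exacts [⟨p, hgv, rfl, rfl, rfl⟩,
      ⟨p.partner, hgv, rfl, rfl, congrArg S.occupant p.partner_partner⟩]
  rcases h.status_pair (g, 0) hgv with e | e
  exacts [key _ rfl e, key (Slot.partner (g, 0)) rfl e]

theorem level_eq : X.level = S.vacant.length := by
  have hfilter : (Finset.univ.filter fun g => (X.status g).isSingle = true) =
      (S.vacant.map Prod.fst).toFinset := by
    ext g
    rw [Finset.mem_filter, List.mem_toFinset]
    by_cases hg : g ∈ S.vacant.map Prod.fst
    · obtain ⟨p, hp, rfl⟩ := List.mem_map.1 hg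
      simp only [h.status_single p hp, hg, GroupStatus.isSingle, Finset.mem_univ, true_and]
    · rcases h.status_pair (g, 0) hg with e | e <;>
        simp only [e, hg, GroupStatus.isSingle, Bool.false_eq_true, and_false]
  rw [VCConfig.level, hfilter, List.toFinset_card_of_nodup S.nodup_groups, List.length_map]

end Status

theorem describes : S.labels.desc.Describes z u X where
  vehicle_inj := S.vehicle_injective
  vehicle_iff c := h.active_iff.trans (S.exists_vehicle_iff c).symm
  sojourn_eq k := h.time_eq ▸ S.labels.eval_sojourn z u k
  recruiter_inj := S.recruiter_injective
  recruiter_iff c := by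
    simp only [h.status_eq_single_iff]
    refine Iff.trans ⟨?_, ?_⟩ (S.exists_recruiter_iff c).symm
    · rintro ⟨_, _, p, hp, -, hc, -⟩
      exact ⟨p, hp, hc⟩
    · rintro ⟨p, hp, hc⟩
      exact ⟨_, _, p, hp, rfl, hc, rfl⟩
  recruitment_eq k g s hg := by
    obtain ⟨p, hp, -, hpk, rfl⟩ := h.status_eq_single_iff.1 hg
    obtain rfl : p = S.vacant.get k := Slot.partner_injective (S.occupant.injective hpk)
    exact h.time_eq ▸ S.labels.eval_recruitment z u k
  recruiter_first _ _ hkl := S.vehicle_eq_recruiter hkl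

theorem pending_iff (e : VCEvent V) (t : ℝ) : Pending z u X e t ↔
    ∃ x, S.labels.event x = e ∧ S.labels.eventTime z u x = t := by
  constructor
  · rintro (hc | hg)
    · obtain ⟨k, rfl⟩ := (h.describes.vehicle_iff _).1 hc
      exact ⟨.inl k, rfl, rfl⟩
    · obtain ⟨p, hp, -, rfl, rfl⟩ := h.status_eq_single_iff.1 hg
      obtain ⟨k, rfl⟩ := List.get_of_mem hp
      exact ⟨.inr k, rfl, rfl⟩
  · rintro ⟨k | k, rfl, rfl⟩
    · exact .depart ((h.describes.vehicle_iff _).2 ⟨k, rfl⟩)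
    · exact .recruit (h.status_single _ (List.get_mem _ k))

theorem notMem_range_occupant (hz : ∀ c, 0 < z c) (hu : ∀ c, 0 < u c) {y : V}
    (hy : ¬ X.Active y) (hzy : S.labels.entryTime z u < z y) : y ∉ Set.range S.occupant := by
  rintro ⟨q, rfl⟩
  exact hy (h.active_iff.2 ⟨q, fun hq =>
    hzy.not_ge (h.timely.occupant_le_entryTime hz hu hq), rfl⟩)

theorem lt_occupant_of_isNext {e : VCEvent V} {t : ℝ} (hn : IsNext z u X e t) (hp : p ∉ S.vacant)
    (he : .depart (S.occupant p) ≠ e) : t < z (S.occupant p) :=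
  hn.2 _ _ (.depart (h.active_iff.2 ⟨p, hp, rfl⟩)) he

theorem lt_completion_of_isNext {e : VCEvent V} {t : ℝ} (hn : IsNext z u X e t)
    (hp : p ∈ S.vacant) (he : .recruit (S.occupant p.partner) ≠ e) :
    t < z (S.occupant p) + u (S.occupant p.partner) :=
  hn.2 _ _ (.recruit (h.status_single p hp)) he

theorem depart (hz : ∀ c, 0 < z c) (hu : ∀ c, 0 < u c) (hp : p.1 ∉ S.vacant.map Prod.fst)
    (hn : IsNext z u X (.depart (S.occupant p)) (z (S.occupant p))) :
    (S.depart p hp).Matches z u ⟨z (S.occupant p), Function.update X.status p.1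
      (.single (S.occupant p.partner) (z (S.occupant p)))⟩ where
  timely := h.timely.depart hz hu hp
    (fun _ hq hqp => h.lt_occupant_of_isNext hn hq fun e =>
      hqp (S.occupant.injective (VCEvent.depart.inj e)))
    fun _ hq => h.lt_completion_of_isNext hn hq nofun
  time_eq := (S.entryTime_depart z u hp).symm
  status_single q hq := by
    rcases List.mem_append.1 hq with hq | hq
    · have hqp : q.1 ≠ p.1 := fun e => hp (e ▸ List.mem_map_of_mem hq)
      exact (Function.update_of_ne hqp ..).trans (h.status_single q hq)
    · obtain rfl := List.mem_singleton.1 hq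
      exact Function.update_self ..
  status_pair q hq := by
    simp only [SymConfig.depart, List.map_append, List.map_singleton, List.mem_append,
      List.mem_singleton, not_or] at hq
    dsimp only
    rw [Function.update_of_ne hq.2]
    exact h.status_pair q hq.1

theorem recruit (hz : ∀ c, 0 < z c) (hu : ∀ c, 0 < u c) (hp : p ∈ S.vacant) {y : V}
    (hn : IsNext z u X (.recruit (S.occupant p.partner))
      (z (S.occupant p) + u (S.occupant p.partner)))
    (hy : ¬ X.Active y) (hzy : z (S.occupant p) + u (S.occupant p.partner) < z y) :
    (S.recruit p hp y).Matches z u ⟨z (S.occupant p) + u (S.occupant p.partner),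
      Function.update X.status p.1 (.pair (S.occupant p.partner) y)⟩ := by
  have hy' : y ∉ Set.range S.occupant :=
    h.notMem_range_occupant hz hu hy ((h.timely.entryTime_lt_completion p hp).trans hzy)
  have hoccupant : ∀ {q}, q ≠ p → (S.recruit p hp y).occupant q = S.occupant q :=
    occupant_recruit_of_ne hp hy'
  refine ⟨h.timely.recruit hz hu hp hy' hzy
      (fun _ hq => h.lt_occupant_of_isNext hn hq nofun)
      (fun _ hq hqp => h.lt_completion_of_isNext hn hq fun e => hqp
        (Slot.partner_injective (S.occupant.injective (VCEvent.recruit.inj e)))),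
    (S.entryTime_recruit z u hp y).symm, fun q hq => ?_, fun q hq => ?_⟩
  · obtain ⟨hqp, hq⟩ := S.nodup_vacant.mem_erase_iff.1 hq
    have hg : q.1 ≠ p.1 := fun e => hqp (eq_of_mem_vacant hq hp e)
    have hqp' : q.partner ≠ p := fun e => partner_notMem_vacant hq (e ▸ hp)
    rw [hoccupant hqp, hoccupant hqp']
    exact (Function.update_of_ne hg ..).trans (h.status_single q hq)
  · dsimp only
    by_cases hg : q.1 = p.1
    · have hself := S.occupant_recruit_self hp y
      have hpartner := hoccupant p.partner_ne
      rw [hg, Function.update_self]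
      rcases Slot.eq_or_eq_partner hg with rfl | rfl
      · exact Or.inr (by rw [hself, hpartner])
      · exact Or.inl (by rw [p.partner_partner, hself, hpartner])
    · have hqp : q ≠ p := fun e => hg (congrArg Prod.fst e)
      have hqp' : q.partner ≠ p := fun e => hg (e ▸ rfl)
      rw [hoccupant hqp, hoccupant hqp', Function.update_of_ne hg]
      refine h.status_pair q fun hqg => hq ?_
      obtain ⟨r, hr, hrq⟩ := List.mem_map.1 hqg
      have hrp : r ≠ p := fun e => hg (hrq.symm.trans (congrArg Prod.fst e))
      exact List.mem_map.2 ⟨r, S.nodup_vacant.mem_erase_iff.2 ⟨hrp, hr⟩, hrq⟩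

theorem step (hz : ∀ c, 0 < z c) (hu : ∀ c, 0 < u c) {m : Move V} {X' : VCConfig V n}
    (hs : Step z u X m (some X')) : (S.next m).Matches z u X' := by
  cases hs with
  | departLeft hg hn =>
    obtain ⟨p, hp, rfl, rfl, rfl⟩ := h.exists_occupant_of_pair (.inl hg)
    exact S.next_depart hp ▸ h.depart hz hu hp hn
  | departRight hg hn =>
    obtain ⟨p, hp, rfl, rfl, rfl⟩ := h.exists_occupant_of_pair (.inr hg)
    exact S.next_depart hp ▸ h.depart hz hu hp hn
  | recruit hg hn hy hzy =>
    obtain ⟨p, hp, rfl, rfl, rfl⟩ := h.status_eq_single_iff.1 hg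
    exact S.next_recruit hp _ ▸ h.recruit hz hu hp hn hy hzy

theorem hState_of_step_depart {c : V} {X' : VCConfig V n}
    (hs : Step z u X (.depart c) (some X')) :
    (S.next (.depart c)).hState = (S.vacant.length + 1, 0) := by
  cases hs with
  | departLeft hg =>
    obtain ⟨p, hp, -, rfl, -⟩ := h.exists_occupant_of_pair (.inl hg)
    exact S.hState_next_depart hp
  | departRight hg =>
    obtain ⟨p, hp, -, rfl, -⟩ := h.exists_occupant_of_pair (.inr hg)
    exact S.hState_next_depart hp

theorem step_depart_eq_none_iff {c : V} {X' : Option (VCConfig V n)}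
    (hs : Step z u X (.depart c) X') : X' = none ↔ ∃ k, S.labels.recruiter k = c := by
  have hne : ∀ {p : Slot n}, p.1 ∉ S.vacant.map Prod.fst →
      ¬ ∃ q ∈ S.vacant, S.occupant q.partner = S.occupant p := by
    rintro p hp ⟨q, hq, e⟩
    exact hp (S.occupant.injective e ▸ List.mem_map.2 ⟨q, hq, rfl⟩)
  rw [S.exists_recruiter_iff]
  cases hs with
  | departLeft hg =>
    obtain ⟨p, hp, -, rfl, -⟩ := h.exists_occupant_of_pair (.inl hg)
    simpa only [reduceCtorEq, false_iff] using hne hp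
  | departRight hg =>
    obtain ⟨p, hp, -, rfl, -⟩ := h.exists_occupant_of_pair (.inr hg)
    simpa only [reduceCtorEq, false_iff] using hne hp
  | fail hg =>
    obtain ⟨p, hp, -, hc, -⟩ := h.status_eq_single_iff.1 hg
    exact iff_of_true rfl ⟨p, hp, hc⟩

theorem distinct (hz : ∀ c, 0 < z c) (hu : ∀ c, 0 < u c) : S.labels.Distinct :=
  (h.timely.admissible hz hu).distinct S.vehicle_injective S.recruiter_injective
    fun _ _ => S.occupant_ne_completer _ (List.get_mem _ _) _

end Matches

section Initial

variable {alloc : Fin n → Fin 2 → V} (ha : Function.Injective (Function.uncurry alloc))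
  {z u : V → ℝ}

theorem matches_initial (hz : ∀ c, 0 < z c) :
    (initial alloc ha).Matches z u ⟨0, fun g => .pair (alloc g 0) (alloc g 1)⟩ where
  timely := by
    constructor <;> simp [initial, HLabels.entryTime, hz]
  time_eq := rfl
  status_single _ hp := absurd hp List.not_mem_nil
  status_pair p _ := by
    obtain ⟨g, b⟩ := p
    fin_cases b
    exacts [Or.inl rfl, Or.inr rfl]

theorem matches_after (hz : ∀ c, 0 < z c) (hu : ∀ c, 0 < u c) {h : List (Move V)}
    {X : VCConfig V n} (hr : Run z u alloc h (some X)) :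
    ((initial alloc ha).after h).Matches z u X := by
  generalize hY : some X = Y at hr
  induction hr generalizing X with
  | start =>
    cases hY
    exact matches_initial ha hz
  | step _ hs ih =>
    subst hY
    exact after_concat _ _ _ ▸ (ih rfl).step hz hu hs

end Initial

end SymConfig

/-! ### The next event -/

theorem Step.ne_none_of_recruit {V : Type*} {n : ℕ} {z u : V → ℝ} {X : VCConfig V n} {c y : V}
    {X' : Option (VCConfig V n)} (hs : Step z u X (.recruit c y) X') : X' ≠ none := by
  cases hs
  exact Option.some_ne_none _

theorem existsUnique_isNext_of_pending_iff {V ι : Type*} [Finite ι] [Nonempty ι] {n : ℕ}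
    {z u : V → ℝ} {X : VCConfig V n} {event : ι → VCEvent V}
    {time : ι → ℝ} (htime : Function.Injective time)
    (hpending : ∀ e t, Pending z u X e t ↔ ∃ x, event x = e ∧ time x = t) :
    ∃! e, ∃ t, IsNext z u X e t := by
  obtain ⟨x, hx⟩ := Finite.exists_min time
  have hpx : Pending z u X (event x) (time x) := (hpending _ _).2 ⟨x, rfl, rfl⟩
  refine ⟨event x, ⟨time x, hpx, fun e t he hne => ?_⟩, ?_⟩
  · obtain ⟨y, rfl, rfl⟩ := (hpending e t).1 he
    exact (hx y).lt_of_ne fun hxy => hne (congrArg event (htime hxy.symm))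
  · rintro e ⟨t, he, hmin⟩
    obtain ⟨y, rfl, rfl⟩ := (hpending e t).1 he
    by_contra hne
    exact (hmin _ _ hpx (Ne.symm hne)).not_ge (hx y)

theorem nonempty_entries {n i : ℕ} (hn : 0 < n) (hi : i ≤ n) :
    Nonempty (Fin (2 * n - i) ⊕ Fin i) :=
  ⟨.inl ⟨0, by omega⟩⟩

theorem SymConfig.Matches.existsUnique_isNext {V : Type*} {n : ℕ} {z u : V → ℝ}
    {S : SymConfig V n} {X : VCConfig V n} (h : S.Matches z u X) (hn : 0 < n)
    (hg : Generic z u) : ∃! e, ∃ t, IsNext z u X e t :=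
  have := nonempty_entries hn S.length_vacant_le
  existsUnique_isNext_of_pending_iff
    ((h.distinct hg.pos_z hg.pos_u).eventTime_injective hg) h.pending_iff

/-! ### The kernel of the decomposed process -/

theorem card_hStates {n i : ℕ} (hi : i < n) : (hStates n i).card = i + 2 := by
  rw [hStates, if_pos hi, Finset.card_image_of_injective _ (Prod.mk_right_injective i),
    Finset.card_range]

theorem card_hStates_self (n : ℕ) : (hStates n n).card = 1 := by
  rw [hStates, if_neg (lt_irrefl n), Finset.card_singleton]

theorem H_mem_dStates {n i j : ℕ} (hi : i ≤ n) (hj : (i, j) ∈ hStates n i) :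
    DState.H i j ∈ dStates n :=
  Finset.mem_insert_of_mem (Finset.mem_biUnion.2 ⟨i, Finset.mem_range.2 (Nat.lt_succ_of_le hi),
    Finset.mem_image.2 ⟨(i, j), hj, rfl⟩⟩)

theorem dTarget_mem_dStates {n i : ℕ} (hi : i ≤ n) (e : Fin (2 * n - i) ⊕ Fin i) :
    dTarget n i e ∈ dStates n := by
  rcases e with k | k
  · rw [dTarget]
    split_ifs with hk
    · exact Finset.mem_insert_self _ _
    · have hin : i + 1 ≤ n := by omega
      refine H_mem_dStates hin ?_
      rcases hin.lt_or_eq with hlt | rfl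
      · simp [hStates, hlt]
      · simp [hStates]
  · have hin : i - 1 < n := by have := k.2; omega
    refine H_mem_dStates hin.le ?_
    rw [hStates, if_pos hin]
    exact Finset.mem_image_of_mem _ (Finset.mem_range.2 (by have := k.2; omega))

section Kernel

variable {n i : ℕ}

/-- The residual times for which the process moves from an H-state of `S_i` to the state `s`: the
strictly smallest of them belongs to an event leading to `s`. -/
def exitSet (n i : ℕ) (s : DState) : Set (Residuals n i) :=
  {p | ∃ e, dTarget n i e = s ∧ ∀ e', e' ≠ e → Sum.elim p.1 p.2 e < Sum.elim p.1 p.2 e'}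

theorem measurable_elim_residuals (e : Fin (2 * n - i) ⊕ Fin i) :
    Measurable fun p : Residuals n i => Sum.elim p.1 p.2 e := by
  rcases e with k | k
  · exact (measurable_pi_apply k).comp measurable_fst
  · exact (measurable_pi_apply k).comp measurable_snd

theorem measurableSet_exitSet (s : DState) : MeasurableSet (exitSet n i s) := by
  simp only [exitSet, Set.ofPred_exists, Set.ofPred_and, Set.ofPred_forall]
  exact .iUnion fun e => (MeasurableSet.const _).inter (.iInter fun e' => .iInter fun _ =>
    measurableSet_lt (measurable_elim_residuals e) (measurable_elim_residuals e'))

theorem measurableSet_injective_elim :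
    MeasurableSet {p : Residuals n i | Function.Injective (Sum.elim p.1 p.2)} := by
  simp only [Function.injective_iff_pairwise_ne, Pairwise, Set.ofPred_forall]
  exact .iInter fun e => .iInter fun e' => .iInter fun _ =>
    (measurableSet_eq_fun (measurable_elim_residuals e) (measurable_elim_residuals e')).compl

theorem pairwise_disjoint_exitSet : Pairwise (Function.onFun Disjoint (exitSet n i)) := by
  refine fun s s' hs => Set.disjoint_left.2 ?_
  rintro p ⟨e, rfl, he⟩ ⟨e', rfl, he'⟩
  have hne : e ≠ e' := fun h => hs (congrArg _ h)
  exact lt_asymm (he e' hne.symm) (he' e hne)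

theorem mem_iUnion_exitSet (hn : 0 < n) (hi : i ≤ n) {p : Residuals n i}
    (hp : Function.Injective (Sum.elim p.1 p.2)) : p ∈ ⋃ s ∈ dStates n, exitSet n i s := by
  have := nonempty_entries hn hi
  obtain ⟨e, he⟩ := Finite.exists_min (Sum.elim p.1 p.2)
  exact Set.mem_biUnion (dTarget_mem_dStates hi e)
    ⟨e, rfl, fun e' hne => (he e').lt_of_ne (hp.ne hne.symm)⟩

theorem iSup_dKernel (ν : ∀ i _j : ℕ, Measure (Residuals n i)) (i j : ℕ) (s : DState) :
    ⨆ t : ℝ, dKernel n ν i j s t = ν i j (exitSet n i s) := by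
  simp only [dKernel]
  rw [← Monotone.measure_iUnion]
  · congr 1
    ext p
    simp only [Set.mem_iUnion]
    exact ⟨fun ⟨_, e, hs, _, he⟩ => ⟨e, hs, he⟩, fun ⟨e, hs, he⟩ => ⟨_, e, hs, le_rfl, he⟩⟩
  · rintro t t' htt' p ⟨e, hs, ht, he⟩
    exact ⟨e, hs, ht.trans htt', he⟩

theorem sum_iSup_dKernel (ν : ∀ i _j : ℕ, Measure (Residuals n i)) {j : ℕ} (hn : 0 < n)
    (hi : i ≤ n) (hν : ∀ᵐ p ∂(ν i j), Function.Injective (Sum.elim p.1 p.2)) :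
    ∑ s ∈ dStates n, ⨆ t : ℝ, dKernel n ν i j s t = ν i j Set.univ := by
  simp only [iSup_dKernel]
  rw [← measure_biUnion_finset (pairwise_disjoint_exitSet.set_pairwise _)
    fun s _ => measurableSet_exitSet s]
  exact measure_congr (Filter.eventuallyEq_univ.2
    (hν.mono fun _ hp => mem_iUnion_exitSet hn hi hp))

end Kernel

namespace HLabels

variable {Ω V : Type*} [MeasurableSpace Ω] {μ : Measure Ω} [IsProbabilityMeasure μ]
  {Z U : V → Ω → ℝ} {lam : ℝ} {R : Measure ℝ} {n i j : ℕ} {L : HLabels V n i j}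

theorem Distinct.ae_injective_jointLaw [Countable V] (hL : L.Distinct)
    (H : IsSeSVC μ Z U lam R) (hR : R (Set.Iic 0) = 0) :
    ∀ᵐ p ∂(L.desc.jointLaw μ Z U), Function.Injective (Sum.elim p.1 p.2) := by
  rw [HDesc.jointLaw, ae_map_iff (L.desc.measurable_values H.measurable_elim).aemeasurable
    measurableSet_injective_elim]
  refine cond_absolutelyContinuous.ae_le ?_
  filter_upwards [H.ae_generic hR] with ω hω e e' he
  rw [elim_values, elim_values] at he
  exact hL.eventTime_injective hω (sub_left_injective he)

theorem isProbabilityMeasure_jointLaw (H : IsSeSVC μ Z U lam R)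
    (hrel : μ {ω | L.desc.Relations (Z · ω) (U · ω)} ≠ 0) :
    IsProbabilityMeasure (L.desc.jointLaw μ Z U) :=
  have := cond_isProbabilityMeasure hrel
  Measure.isProbabilityMeasure_map (L.desc.measurable_values H.measurable_elim).aemeasurable

theorem sum_iSup_dKernel_hLaw [Countable V] (H : IsSeSVC μ Z U lam R) (hR : R (Set.Iic 0) = 0)
    (hn : 0 < n) (hi : i ≤ n) (hL : L.Distinct)
    (hrel : μ {ω | L.desc.Relations (Z · ω) (U · ω)} ≠ 0) :
    ∑ s ∈ dStates n, ⨆ t : ℝ, dKernel n (hLaw n lam R) i j s t = 1 := by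
  have hprob := isProbabilityMeasure_jointLaw H hrel
  have hinj := hL.ae_injective_jointLaw H hR
  rw [hL.jointLaw_eq H] at hprob hinj
  rw [sum_iSup_dKernel _ hn hi hinj, measure_univ]

end HLabels

/-! ### Histories of positive probability -/

namespace SymConfig

section Frequently

variable {Ω V : Type*} [MeasurableSpace Ω] {μ : Measure Ω} {Z U : V → Ω → ℝ} {n : ℕ}
  {S : SymConfig V n}
  (hS : ∃ᵐ ω ∂μ, Generic (Z · ω) (U · ω) ∧ ∃ X, S.Matches (Z · ω) (U · ω) X)

include hS

theorem distinct_of_frequently_matches : S.labels.Distinct := by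
  obtain ⟨ω, hω, X, hM⟩ := hS.exists
  exact hM.distinct hω.pos_z hω.pos_u

theorem measure_relations_ne_zero_of_frequently_matches :
    μ {ω | S.labels.desc.Relations (Z · ω) (U · ω)} ≠ 0 :=
  frequently_ae_iff.1 (hS.mono fun _ ⟨hω, _, hM⟩ =>
    (hM.timely.admissible hω.pos_z hω.pos_u).relations S.recruiter_injective)

end Frequently

theorem frequently_matches_after {Ω V : Type*} [Countable V] [MeasurableSpace Ω] {μ : Measure Ω}
    [IsProbabilityMeasure μ] {Z U : V → Ω → ℝ} {lam : ℝ} {R : Measure ℝ}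
    (H : IsSeSVC μ Z U lam R) (hR : R (Set.Iic 0) = 0) {n : ℕ} {alloc : Fin n → Fin 2 → V}
    (ha : Function.Injective (Function.uncurry alloc)) {h : List (Move V)}
    (hpos : μ {ω | ∃ X, Run (Z · ω) (U · ω) alloc h (some X)} ≠ 0) :
    ∃ᵐ ω ∂μ, Generic (Z · ω) (U · ω) ∧
      ∃ X, ((initial alloc ha).after h).Matches (Z · ω) (U · ω) X :=
  ((frequently_ae_iff.2 hpos).and_eventually (H.ae_generic hR)).mono fun _ ⟨⟨X, hr⟩, hω⟩ =>
    ⟨hω, X, matches_after ha hω.pos_z hω.pos_u hr⟩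

end SymConfig

theorem theorem1 (n : ℕ) (hn : 0 < n) (lam : ℝ) (hlam : 0 < lam)
    (R : Measure ℝ) [IsProbabilityMeasure R] (hR : R (Set.Iic 0) = 0) :
    -- each `S_i` is decomposed into `i + 2` H-states, except for `S_n`
    ((∀ i < n, (hStates n i).card = i + 2) ∧ (hStates n n).card = 1) ∧
    -- laws of the residual times in the H-states, depending on `n`, `lam` and `R` only
    ∃ ν : ∀ i _j : ℕ, Measure (Residuals n i),
      ∀ (Ω : Type*) [MeasurableSpace Ω] (μ : Measure Ω) [IsProbabilityMeasure μ]
        (V : Type*) [Countable V] (Z U : V → Ω → ℝ) (_ : IsSeSVC μ Z U lam R)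
        (alloc : Fin n → Fin 2 → V) (_ : Function.Injective (Function.uncurry alloc)),
        -- the H-state reached after each history, and its description
        ∃ (hs : List (Move V) → ℕ × ℕ) (desc : ∀ h, HDesc V n (hs h).1),
          hs [] = (0, 0) ∧
          (∀ᵐ ω ∂μ, ∀ (h : List (Move V)) (X : VCConfig V n),
            Run (fun c => Z c ω) (fun c => U c ω) alloc h (some X) →
              (hs h).1 = X.level ∧ hs h ∈ hStates n X.level ∧
              (desc h).Describes (fun c => Z c ω) (fun c => U c ω) X ∧
              (desc h).IsHState μ Z U lam R ω (hs h).2 ∧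
              (∀ k, (desc h).order (fun c => Z c ω) (fun c => U c ω) k = k + 1) ∧
              -- exactly one of the scheduled events occurs next
              (∃! e, ∃ t, IsNext (fun c => Z c ω) (fun c => U c ω) X e t) ∧
              -- transitions
              (∀ c X', Step (fun c => Z c ω) (fun c => U c ω) X (.depart c) (some X') →
                hs (h ++ [.depart c]) = ((hs h).1 + 1, 0)) ∧
              (∀ k y X', Step (fun c => Z c ω) (fun c => U c ω) X
                  (.recruit ((desc h).recruiter k) y) X' →
                X' ≠ none ∧ hs (h ++ [.recruit ((desc h).recruiter k) y]) =
                  ((hs h).1 - 1,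
                    (desc h).order (fun c => Z c ω) (fun c => U c ω) k)) ∧
              (∀ c X', Step (fun c => Z c ω) (fun c => U c ω) X (.depart c) X' →
                (X' = none ↔ ∃ k, (desc h).recruiter k = c))) ∧
          -- time-homogeneity: the joint law of the lists depends on the H-state only, and the
          -- kernel of the decomposed process which these laws determine has total mass one
          (∀ h, μ {ω | ∃ X, Run (fun c => Z c ω) (fun c => U c ω) alloc h (some X)} ≠ 0 →
            (desc h).jointLaw μ Z U = ν (hs h).1 (hs h).2 ∧
            ∑ s ∈ dStates n, ⨆ t : ℝ, dKernel n ν (hs h).1 (hs h).2 s t = 1) := by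
  refine ⟨⟨fun _ => card_hStates, card_hStates_self n⟩, hLaw n lam R, ?_⟩
  intro Ω _ μ _ V _ Z U H alloc ha
  let S : List (Move V) → SymConfig V n := (SymConfig.initial alloc ha).after
  have hS : ∀ h m, S (h ++ [m]) = (S h).next m := SymConfig.after_concat _
  refine ⟨fun h => (S h).hState, fun h => (S h).labels.desc, rfl, ?_, fun h hpos => ?_⟩
  · filter_upwards [H.ae_generic hR] with ω hω h X hr
    have hM : (S h).Matches (Z · ω) (U · ω) X :=
      SymConfig.matches_after ha hω.pos_z hω.pos_u hr
    have hA := hM.timely.admissible hω.pos_z hω.pos_u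
    have horder := hA.order_eq (S h).recruiter_injective
    refine ⟨hM.level_eq.symm, hM.level_eq ▸ (S h).hState_mem_hStates, hM.describes,
      HLabels.isHState H hR (hM.distinct hω.pos_z hω.pos_u) hA
        (Nat.sub_le_of_le_add (S h).order_le), horder, hM.existsUnique_isNext hn hω,
      fun c X' hs => ?_, fun k y X' hs => ⟨hs.ne_none_of_recruit, ?_⟩,
      fun c X' hs => hM.step_depart_eq_none_iff hs⟩
    · exact (congrArg _ (hS h _)).trans (hM.hState_of_step_depart hs)
    · exact (congrArg _ (hS h _)).trans
        (((S h).hState_next_recruit k y).trans (congrArg _ (horder k).symm))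
  · have hfreq := SymConfig.frequently_matches_after H hR ha hpos
    have hL := SymConfig.distinct_of_frequently_matches hfreq
    exact ⟨hL.jointLaw_eq H, HLabels.sum_iSup_dKernel_hLaw H hR hn (S h).length_vacant_le hL
      (SymConfig.measure_relations_ne_zero_of_frequently_matches hfreq)⟩
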